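/- **Theorem 3.2 ($L_1$-approximation theorem for short memory time series).** Let $\{X_t\}_{t\in\mathbb Z}$ be a real, centered, second-order stationary process on a probability space with $\mathrm{var}(X_0)>0$. Write $\|\cdot\|$ for the norm of $L^2(P)$ and $V_{(-\infty,n]}$ for the closed linear span of $\{X_k:k\le n\}$ in $L^2(P)$, and suppose that $\{X_t\}$ is purely nondeterministic: $\bigcap_{n\in\mathbb Z} V_{(-\infty,n]}=\{0\}$. Let $\varepsilon_t=X_t-P_{(-\infty,t-1]}X_t$ be the innovations, where $P_{(-\infty,t-1]}$ is the orthogonal projection onto $V_{(-\infty,t-1]}$, and let $\sigma^2=\|\varepsilon_0\|^2>0$. Let $\{\psi_j\}_{j\ge0}$ be the MA coefficients of the Wold decomposition $X_t=\sum_{j\ge0}\psi_j\varepsilon_{t-j}$, that is, $\psi_j=\mathbb E[X_0\varepsilon_{-j}]/\sigma^2$ (so $\psi_0=1$), and let $\{\phi_j\}_{j\ge0}$ be the AR coefficients, defined by $\phi_0=-1$ and $\bigl(\sum_{j\ge0}\psi_jz^j\bigr)^{-1}=1-\sum_{j\ge1}\phi_jz^j$. Assume that, for some $\alpha\ge0$,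 $$\sum_{j\ge0}(1+j)^\alpha|\psi_j|<\infty\quad\text{and}\quad\sum_{j\ge0}(1+j)^\alpha|\phi_j|<\infty .$$ For real filter coefficients $\{h_k\}_{k\in\mathbb Z}$ consider the target $Y_n=\sum_{k\in\mathbb Z}h_kX_{n-k}$ (convergence in $L^2(P)$). Let $\{\hat h_k\}_{k\ge1}$ be the real sequence, the same for every $n\ge1$, for which $\sum_{k\ge1}\hat h_kX_{n+1-k}$ converges in $L^2(P)$ and minimizes $\|Y_n-\sum_{k\ge1}a_kX_{n+1-k}\|^2$ among all real sequences $\{a_k\}$ for which the series converges. For $n\ge1$ let $\{\hat h_{k,n}\}_{k=1}^n$ be the real coefficients minimizing $\|Y_n-\sum_{k=1}^na_kX_{n+1-k}\|^2$. (i) If $\sum_{k\in\mathbb Z}|h_k|<\infty$, then the series defining $Y_n$ converges, $\{\hat h_k\}$ and $\{\hat h_{k,n}\}$ exist and are unique, and $$\sum_{k=1}^n|\hat h_k-\hat h_{k,n}|=o(n^{-\alpha})+O\Bigl(\sum_{k=n}^\infty|h_k|\Bigr)\quad\text{as }n\to\infty.$$ (ii) If $\alpha\ge1$ and $\sum_{k\in\mathbb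 Z}|h_k|^2<\infty$, then the series defining $Y_n$ converges, $\{\hat h_k\}$ and $\{\hat h_{k,n}\}$ exist and are unique, and $$\sum_{k=1}^n|\hat h_k-\hat h_{k,n}|=o(n^{-\alpha+1})+O\Bigl(\sup_{k\ge n}|h_k|\Bigr)\quad\text{as }n\to\infty.$$ -/

import Mathlib

open MeasureTheory ProbabilityTheory Filter Topology Asymptotics

noncomputable section

/-- `X = (X_t)_{t ∈ ℤ}` is a centered second-order stationary real process on the probability
space `(Ω, P)`. -/
structure IsCenteredStationary {Ω : Type*} [MeasurableSpace Ω] (P : Measure Ω)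
    (X : ℤ → Ω → ℝ) : Prop where
  memLp : ∀ t, MemLp (X t) 2 P
  centered : ∀ t, ∫ ω, X t ω ∂P = 0
  stationary : ∀ s t k : ℤ, cov[X (s + k), X (t + k); P] = cov[X s, X t; P]

/-- The process as a sequence in the real Hilbert space `L²(Ω, P)`. -/
def IsCenteredStationary.toL2 {Ω : Type*} [MeasurableSpace Ω] {P : Measure Ω}
    {X : ℤ → Ω → ℝ} (hX : IsCenteredStationary P X) (t : ℤ) : Lp ℝ 2 P :=
  (hX.memLp t).toLp (X t)

section Hilbert

variable {E : Type*} [NormedAddCommGroup E] [InnerProductSpace ℝ E]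

/-- `V_K`, the closed linear span of `{x_k : k ∈ K}`. -/
def closedSpan (x : ℤ → E) (K : Set ℤ) : Submodule ℝ E :=
  (Submodule.span ℝ (x '' K)).topologicalClosure

/-- The process is purely nondeterministic: the remote past `⋂ₙ V_{(-∞, n]}` is `{0}`. -/
def PurelyNondeterministic (x : ℤ → E) : Prop :=
  ⨅ n : ℤ, closedSpan x (Set.Iic n) = ⊥

variable [CompleteSpace E]

instance closedSpan.hasOrthogonalProjection (x : ℤ → E) (K : Set ℤ) :
    (closedSpan x K).HasOrthogonalProjection := by
  unfold closedSpan
  infer_instance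

/-- The white noise of the Wold decomposition, `ε_t = X_t - P_{(-∞, t-1]} X_t`. -/
def innovation (x : ℤ → E) (t : ℤ) : E :=
  x t - (closedSpan x (Set.Iic (t - 1))).starProjection (x t)

/-- The infinite-order MA coefficients, that is, the Wold coefficients
`ψ_j = (X_0, ε_{-j}) / σ²` with `σ² = ‖ε_0‖²`, so that `ψ_0 = 1` and `X_t = ∑_j ψ_j ε_{t-j}`
for a nonzero purely nondeterministic stationary process. -/
def maCoeff (x : ℤ → E) (j : ℕ) : ℝ :=
  inner ℝ (x 0) (innovation x (-(j : ℤ))) / ‖innovation x 0‖ ^ 2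

/-- The infinite-order AR coefficients: `Ψ(z)⁻¹ = 1 - ∑_{j ≥ 1} φ_j z^j` where
`Ψ(z) = ∑_j ψ_j z^j`, with the convention `φ_0 = -1`. -/
def arCoeff (x : ℤ → E) (j : ℕ) : ℝ :=
  -PowerSeries.coeff j (PowerSeries.mk (maCoeff x))⁻¹

end Hilbert

/-- The weighted space `C_α^+`: `∑_{j ≥ 0} (1 + j)^α |a_j| < ∞`. -/
def MemCPlus (α : ℝ) (a : ℕ → ℝ) : Prop :=
  Summable fun j : ℕ => (1 + (j : ℝ)) ^ α * |a j|

/-- Condition (SM_α). -/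
structure ShortMemory {E : Type*} [NormedAddCommGroup E] [InnerProductSpace ℝ E]
    [CompleteSpace E] (x : ℤ → E) (α : ℝ) : Prop where
  purelyNondeterministic : PurelyNondeterministic x
  ma : MemCPlus α (maCoeff x)
  ar : MemCPlus α (arCoeff x)

section Prediction

variable {E : Type*} [NormedAddCommGroup E] [InnerProductSpace ℝ E]

/-- The target `Y_n = ∑_{k ∈ ℤ} h_k X_{n-k}`. -/
def target (x : ℤ → E) (h : ℤ → ℝ) (n : ℤ) : E :=
  ∑' k : ℤ, h k • x (n - k)

/-- `a` is the sequence of infinite predictor coefficients, `a j` standing for `ĥ_{j+1}`: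
for every `n ≥ 1` the series `∑_{k ≥ 1} ĥ_k X_{n+1-k} = ∑_{j ≥ 0} a_j X_{n-j}` converges in norm,
and it minimizes the mean squared error `‖Y_n - ·‖²` among all convergent series of this form. -/
def IsInfinitePredictor (x : ℤ → E) (h : ℤ → ℝ) (a : ℕ → ℝ) : Prop :=
  ∀ n : ℕ, 1 ≤ n → ∃ L : E,
    Tendsto (fun N : ℕ => ∑ j ∈ Finset.range N, a j • x ((n : ℤ) - (j : ℤ))) atTop (𝓝 L) ∧
    ∀ (c : ℕ → ℝ) (M : E),
      Tendsto (fun N : ℕ => ∑ j ∈ Finset.range N, c j • x ((n : ℤ) - (j : ℤ))) atTop (𝓝 M) →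
        ‖target x h n - L‖ ^ 2 ≤ ‖target x h n - M‖ ^ 2

/-- `b` is the vector of finite predictor coefficients, `b j` standing for `ĥ_{j+1,n}`:
`∑_{k=1}^n ĥ_{k,n} X_{n+1-k} = ∑_{j=0}^{n-1} b_j X_{n-j}` minimizes the mean squared error among
all linear combinations of `X_1, …, X_n`. -/
def IsFinitePredictor (x : ℤ → E) (h : ℤ → ℝ) (n : ℕ) (b : Fin n → ℝ) : Prop :=
  ∀ c : Fin n → ℝ,
    ‖target x h n - ∑ j : Fin n, b j • x ((n : ℤ) - ((j : ℕ) : ℤ))‖ ^ 2 ≤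
      ‖target x h n - ∑ j : Fin n, c j • x ((n : ℤ) - ((j : ℕ) : ℤ))‖ ^ 2

/-- The prediction problem is well posed: the series defining each target converges, and the
infinite and finite predictor coefficients exist and are unique. -/
structure PredictionWellPosed (x : ℤ → E) (h : ℤ → ℝ) : Prop where
  target_summable : ∀ n : ℤ, Summable fun k : ℤ => h k • x (n - k)
  infinite : ∃! a : ℕ → ℝ, IsInfinitePredictor x h a
  finite : ∀ n : ℕ, 1 ≤ n → ∃! b : Fin n → ℝ, IsFinitePredictor x h n b

end Prediction

/-- `S n = o(f n) + O(g n)` as `n → ∞`. -/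
def IsLittleOAddBigO (S f g : ℕ → ℝ) : Prop :=
  ∃ u v : ℕ → ℝ, u =o[atTop] f ∧ v =O[atTop] g ∧ ∀ᶠ n in atTop, S n = u n + v n

end

/-! Both predictors are projections of the target, so both residuals are orthogonal to X_1,…,X_n.
Let d be the difference of the two coefficient vectors on the window. Subtracting the normal
equations shows that the autocovariance Toeplitz matrix applied to d is, up to sign and reversal,
the vector of correlations of X_1,…,X_n with the tail ∑_{j≥n} a_j X_{n-j} of the infinite predictor.
By Baxter's inequality (`exists_baxter_bound`) the inverse matrices are bounded in ℓ¹ for large n,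
so it remains to estimate these correlations in ℓ¹.

The infinite predictor is explicit (`hasSum_predictor`). The past part of the target predicts
itself, the future part projects to ∑ g_l ε_{n-l}, and the AR representation rewrites innovations in
terms of X, so a = h - g * φ. The sequence g correlates h with ψ: it inherits the weight β = α when
h is summable, while a merely bounded h costs one power, β = α - 1. The tail of g * φ is then
o(n^{-β}). The tail of h contributes at most ∑_{k≥n} |h_k| times ∑ |γ(k)|, or sup_{k≥n} |h_k| times
∑∑ |γ(i+j+1)|, which is finite when α ≥ 1.

Baxter's inequality comes from factoring the Toeplitz operator into Ψ of the forward shift followed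
by Ψ of the backward shift, each inverted by -Φ. Away from the left end of the window, truncation
costs only a tail of φ (`sum_abs_Ico_le`). Reversal treats the other half, and for large n the error
is absorbed. -/

noncomputable section

namespace StationarySequence

/-! ### Stationary sequences, innovations and the Wold decomposition -/

section

variable {E : Type*} [NormedAddCommGroup E] [InnerProductSpace ℝ E]

/-- Second-order stationarity of a sequence in a Hilbert space. -/
def IsStationary (x : ℤ → E) : Prop :=
  ∀ s t k : ℤ, inner ℝ (x (s + k)) (x (t + k)) = inner ℝ (x s) (x t)

theorem mem_closedSpan (x : ℤ → E) {K : Set ℤ} {k : ℤ} (hk : k ∈ K) : x k ∈ closedSpan x K :=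
  Submodule.le_topologicalClosure _ (Submodule.subset_span ⟨k, hk, rfl⟩)

theorem isClosed_closedSpan (x : ℤ → E) (K : Set ℤ) : IsClosed (closedSpan x K : Set E) :=
  Submodule.isClosed_topologicalClosure _

theorem closedSpan_le {x : ℤ → E} {K : Set ℤ} {V : Submodule ℝ E} (hV : IsClosed (V : Set E))
    (h : ∀ k ∈ K, x k ∈ V) : closedSpan x K ≤ V := by
  refine Submodule.topologicalClosure_minimal _ (Submodule.span_le.2 ?_) hV
  rintro _ ⟨k, hk, rfl⟩
  exact h k hk

theorem closedSpan_mono (x : ℤ → E) {K L : Set ℤ} (h : K ⊆ L) :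
    closedSpan x K ≤ closedSpan x L :=
  closedSpan_le (isClosed_closedSpan x L) fun _ hk => mem_closedSpan x (h hk)

theorem inner_eq_zero_of_mem_closedSpan {x : ℤ → E} {K : Set ℤ} {v w : E}
    (h : ∀ k ∈ K, inner ℝ (x k) v = 0) (hw : w ∈ closedSpan x K) : inner ℝ w v = 0 := by
  have : closedSpan x K ≤ (ℝ ∙ v)ᗮ :=
    closedSpan_le (Submodule.isClosed_orthogonal _) fun k hk => by
      rw [Submodule.mem_orthogonal_singleton_iff_inner_left]
      exact h k hk
  exact Submodule.mem_orthogonal_singleton_iff_inner_left.1 (this hw)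

theorem IsStationary.inner_linearCombination {x : ℤ → E} (hx : IsStationary x) (k : ℤ)
    (f g : ℤ →₀ ℝ) :
    inner ℝ (Finsupp.linearCombination ℝ (fun t => x (t + k)) f)
      (Finsupp.linearCombination ℝ (fun t => x (t + k)) g) =
    inner ℝ (Finsupp.linearCombination ℝ x f) (Finsupp.linearCombination ℝ x g) := by
  simp only [Finsupp.linearCombination_apply, Finsupp.sum, sum_inner, inner_sum, inner_smul_left,
    inner_smul_right, hx _ _ k]

theorem IsStationary.norm_linearCombination {x : ℤ → E} (hx : IsStationary x) (k : ℤ)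
    (f : ℤ →₀ ℝ) :
    ‖Finsupp.linearCombination ℝ (fun t => x (t + k)) f‖ = ‖Finsupp.linearCombination ℝ x f‖ := by
  have := hx.inner_linearCombination k f f
  rw [real_inner_self_eq_norm_sq, real_inner_self_eq_norm_sq] at this
  exact (sq_eq_sq₀ (norm_nonneg _) (norm_nonneg _)).1 this

variable [CompleteSpace E]

/-- Shifting indices is isometric on finite combinations, so approximants of `v` shift to a Cauchy
sequence with limit `w`. Inner products with the `x t` suffice to recognise projections, so no
unitary shift is constructed. -/
theorem IsStationary.exists_shift {x : ℤ → E} (hx : IsStationary x) (k : ℤ) {K : Set ℤ} {v : E}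
    (hv : v ∈ closedSpan x K) :
    ∃ w ∈ closedSpan x ((fun t => t + k) '' K),
      ∀ t, inner ℝ (x (t + k)) w = inner ℝ (x t) v := by
  obtain ⟨u, hu, huv⟩ := mem_closure_iff_seq_limit.1
    (show v ∈ closure (Submodule.span ℝ (x '' K) : Set E) from hv)
  have hf : ∀ n, ∃ f ∈ Finsupp.supported ℝ ℝ K, Finsupp.linearCombination ℝ x f = u n :=
    fun n => (Finsupp.mem_span_image_iff_linearCombination ℝ).1 (hu n)
  choose f hfK hfu using hf
  set w : ℕ → E := fun n => Finsupp.linearCombination ℝ (fun t => x (t + k)) (f n) with hw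
  have hdist : ∀ n m, dist (w n) (w m) = dist (u n) (u m) := fun n m => by
    rw [dist_eq_norm, dist_eq_norm, hw, ← hfu, ← hfu, ← map_sub, ← map_sub,
      hx.norm_linearCombination]
  have hcau : CauchySeq w := by
    have := huv.cauchySeq
    rw [Metric.cauchySeq_iff] at this ⊢
    simpa only [hdist] using this
  obtain ⟨l, hl⟩ := cauchySeq_tendsto_of_complete hcau
  refine ⟨l, (isClosed_closedSpan x _).mem_of_tendsto hl (Eventually.of_forall fun n => ?_), ?_⟩
  · refine Submodule.le_topologicalClosure _ ?_
    simp only [hw, Finsupp.linearCombination_apply, Finsupp.sum]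
    exact Submodule.sum_mem _ fun t ht => Submodule.smul_mem _ _
      (Submodule.subset_span ⟨t + k, ⟨t, hfK n ht, rfl⟩, rfl⟩)
  · intro t
    have h1 : Tendsto (fun n => inner ℝ (x (t + k)) (w n)) atTop (𝓝 (inner ℝ (x (t + k)) l)) :=
      tendsto_const_nhds.inner hl
    have h2 : Tendsto (fun n => inner ℝ (x t) (u n)) atTop (𝓝 (inner ℝ (x t) v)) :=
      tendsto_const_nhds.inner huv
    refine tendsto_nhds_unique h1 (h2.congr fun n => ?_)
    have := hx.inner_linearCombination k (Finsupp.single t 1) (f n)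
    simpa [hfu] using this.symm

theorem inner_innovation_of_lt (x : ℤ → E) {s t : ℤ} (h : t < s) :
    inner ℝ (x t) (innovation x s) = 0 :=
  Submodule.sub_starProjection_mem_orthogonal (x s) _
    (mem_closedSpan x (show t ∈ Set.Iic (s - 1) from Int.le_sub_one_of_lt h))

theorem innovation_mem (x : ℤ → E) {s t : ℤ} (h : s ≤ t) :
    innovation x s ∈ closedSpan x (Set.Iic t) :=
  Submodule.sub_mem _ (mem_closedSpan x h)
    (closedSpan_mono x (Set.Iic_subset_Iic.2 (by omega)) (Submodule.starProjection_apply_mem _ _))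

theorem inner_innovation_of_mem {x : ℤ → E} {s t : ℤ} (h : t < s) {v : E}
    (hv : v ∈ closedSpan x (Set.Iic t)) : inner ℝ v (innovation x s) = 0 :=
  inner_eq_zero_of_mem_closedSpan (fun _ hk => inner_innovation_of_lt x
    (lt_of_le_of_lt (Set.mem_Iic.1 hk) h)) hv

theorem inner_innovation_innovation (x : ℤ → E) {s t : ℤ} (h : s ≠ t) :
    inner ℝ (innovation x s) (innovation x t) = 0 := by
  rcases h.lt_or_gt with h | h
  · exact inner_innovation_of_mem h (innovation_mem x le_rfl)
  · rw [real_inner_comm]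
    exact inner_innovation_of_mem h (innovation_mem x le_rfl)

theorem inner_self_innovation (x : ℤ → E) (t : ℤ) :
    inner ℝ (x t) (innovation x t) = ‖innovation x t‖ ^ 2 := by
  have h : inner ℝ (x t - innovation x t) (innovation x t) = 0 := by
    refine inner_innovation_of_mem (sub_one_lt t) ?_
    simp only [innovation, sub_sub_cancel]
    exact Submodule.starProjection_apply_mem _ _
  rw [inner_sub_left, real_inner_self_eq_norm_sq] at h
  linarith

/-- The shift carries projections to projections: the shifted vector lies in the shifted past and
leaves an orthogonal residual. -/
theorem IsStationary.inner_innovation_add {x : ℤ → E} (hx : IsStationary x) (s t k : ℤ) :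
    inner ℝ (x (t + k)) (innovation x (s + k)) = inner ℝ (x t) (innovation x s) := by
  obtain ⟨w, hw, hwv⟩ := hx.exists_shift k
    (Submodule.starProjection_apply_mem (closedSpan x (Set.Iic (s - 1))) (x s))
  have hK : (fun t => t + k) '' Set.Iic (s - 1) = Set.Iic (s + k - 1) := by
    rw [Set.image_add_const_Iic]; congr 1; ring
  rw [hK] at hw
  have h : ∀ t, inner ℝ (x (t + k)) (x (s + k) - w) = inner ℝ (x t) (innovation x s) := by
    intro t
    rw [innovation, inner_sub_right, inner_sub_right, hwv, hx]
  have hproj : (closedSpan x (Set.Iic (s + k - 1))).starProjection (x (s + k)) = w := by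
    refine Submodule.eq_starProjection_of_mem_of_inner_eq_zero hw fun v hv => ?_
    rw [real_inner_comm]
    refine inner_eq_zero_of_mem_closedSpan (fun j hj => ?_) hv
    have := h (j - k)
    rw [sub_add_cancel] at this
    rw [this]
    exact inner_innovation_of_lt x (by have := Set.mem_Iic.1 hj; omega)
  rw [← h t, innovation, hproj]

theorem IsStationary.norm_innovation {x : ℤ → E} (hx : IsStationary x) (t : ℤ) :
    ‖innovation x t‖ = ‖innovation x 0‖ := by
  have := hx.inner_innovation_add 0 0 t
  rw [zero_add, inner_self_innovation, inner_self_innovation] at this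
  exact (sq_eq_sq₀ (norm_nonneg _) (norm_nonneg _)).1 this

/-- If one innovation vanished, all would by stationarity, every past would equal the preceding one,
and `x 0` would lie in the remote past. -/
theorem IsStationary.norm_innovation_pos {x : ℤ → E} (hx : IsStationary x)
    (hnd : PurelyNondeterministic x) (h0 : x 0 ≠ 0) : 0 < ‖innovation x 0‖ := by
  by_contra hcon
  have hz : ∀ t, innovation x t = 0 := fun t => by
    rw [← norm_le_zero_iff, hx.norm_innovation]; exact not_lt.1 hcon
  have hstep : ∀ t, closedSpan x (Set.Iic t) ≤ closedSpan x (Set.Iic (t - 1)) := fun t => by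
    refine closedSpan_le (isClosed_closedSpan x _) fun k hk => ?_
    rcases (Set.mem_Iic.1 hk).lt_or_eq with h | rfl
    · exact mem_closedSpan x (Set.mem_Iic.2 (by omega))
    · rw [sub_eq_zero.1 (hz k)]
      exact Submodule.starProjection_apply_mem _ _
  have hall : ∀ m : ℕ, closedSpan x (Set.Iic 0) ≤ closedSpan x (Set.Iic (-(m : ℤ))) := by
    intro m
    induction m with
    | zero => simp
    | succ m ih =>
      refine ih.trans ((hstep _).trans (le_of_eq ?_))
      congr 2; push_cast; ring
  refine h0 ((Submodule.mem_bot ℝ).1 ?_)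
  have hnd' : ⨅ n : ℤ, closedSpan x (Set.Iic n) = ⊥ := hnd
  rw [← hnd', Submodule.mem_iInf]
  intro n
  refine closedSpan_mono x (Set.Iic_subset_Iic.2 (show -(n.natAbs : ℤ) ≤ n by omega))
    (hall _ (mem_closedSpan x (Set.mem_Iic.2 le_rfl)))

theorem IsStationary.inner_innovation_sub {x : ℤ → E} (hx : IsStationary x)
    (hpos : 0 < ‖innovation x 0‖) (t : ℤ) (j : ℕ) :
    inner ℝ (x t) (innovation x (t - j)) = ‖innovation x 0‖ ^ 2 * maCoeff x j := by
  have := hx.inner_innovation_add (-(j : ℤ)) 0 t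
  rw [zero_add, show -(j : ℤ) + t = t - j by ring] at this
  rw [this, maCoeff]
  field_simp

theorem IsStationary.maCoeff_zero {x : ℤ → E} (hx : IsStationary x)
    (hpos : 0 < ‖innovation x 0‖) : maCoeff x 0 = 1 := by
  have := hx.inner_innovation_sub hpos 0 0
  simp only [Nat.cast_zero, sub_zero, inner_self_innovation] at this
  have h2 : ‖innovation x 0‖ ^ 2 ≠ 0 := by positivity
  exact (mul_left_cancel₀ h2 (by rw [mul_one]; exact this)).symm

/-- The one-sided orthogonal expansion truncates to the projection on a past. -/
theorem IsStationary.sub_sum_maCoeff_mem {x : ℤ → E} (hx : IsStationary x)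
    (hpos : 0 < ‖innovation x 0‖) (t : ℤ) (m : ℕ) :
    x t - ∑ j ∈ Finset.range m, maCoeff x j • innovation x (t - j) ∈
      closedSpan x (Set.Iic (t - m)) := by
  induction m with
  | zero => simpa using mem_closedSpan x (Set.mem_Iic.2 le_rfl)
  | succ m ih =>
    set u := x t - ∑ j ∈ Finset.range m, maCoeff x j • innovation x (t - j) with hu
    have hinner : inner ℝ u (innovation x (t - m)) = ‖innovation x 0‖ ^ 2 * maCoeff x m := by
      rw [hu, inner_sub_left, hx.inner_innovation_sub hpos, sum_inner, Finset.sum_eq_zero,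
        sub_zero]
      intro j hj
      rw [inner_smul_left, inner_innovation_innovation, mul_zero]
      have := Finset.mem_range.1 hj
      omega
    -- split the span of the past up to `t - m` along its last innovation
    have hdec : ∀ v ∈ closedSpan x (Set.Iic (t - m)),
        v - (inner ℝ v (innovation x (t - m)) / ‖innovation x 0‖ ^ 2) • innovation x (t - m) ∈
          closedSpan x (Set.Iic (t - m - 1)) := by
      -- Removing the last innovation is continuous and linear, so it is enough to check where the
      -- generators `x k` go.
      let T : E →L[ℝ] E := ContinuousLinearMap.id ℝ E -
        ((innerSL ℝ (innovation x (t - m))).smulRight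
          ((‖innovation x 0‖ ^ 2)⁻¹ • innovation x (t - m)))
      have hT : ∀ v, T v = v - (inner ℝ v (innovation x (t - m)) / ‖innovation x 0‖ ^ 2) •
          innovation x (t - m) := fun v => by
        simp [T, real_inner_comm v, smul_smul, div_eq_mul_inv]
      have hle : closedSpan x (Set.Iic (t - m)) ≤
          (closedSpan x (Set.Iic (t - m - 1))).comap (T : E →ₗ[ℝ] E) := by
        refine closedSpan_le ((isClosed_closedSpan x _).preimage T.continuous) fun k hk => ?_
        show T (x k) ∈ closedSpan x (Set.Iic (t - m - 1))
        rw [hT]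
        rcases (Set.mem_Iic.1 hk).lt_or_eq with h | rfl
        · rw [inner_innovation_of_lt x h, zero_div, zero_smul, sub_zero]
          exact mem_closedSpan x (Set.mem_Iic.2 (by omega))
        · rw [inner_self_innovation, hx.norm_innovation, div_self (by positivity), one_smul,
            innovation, sub_sub_cancel]
          exact Submodule.starProjection_apply_mem _ _
      intro v hv
      rw [← hT]
      exact hle hv
    have := hdec u ih
    rw [hinner, mul_div_cancel_left₀ _ (by positivity)] at this
    rw [Finset.sum_range_succ, ← sub_sub, ← hu]
    convert this using 3
    push_cast; ring

theorem IsStationary.norm_smul_innovation {x : ℤ → E} (hx : IsStationary x) (c : ℝ) (t : ℤ) :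
    ‖c • innovation x t‖ = |c| * ‖innovation x 0‖ := by
  rw [norm_smul, hx.norm_innovation, Real.norm_eq_abs]

/-- The Wold decomposition, for summable coefficients. -/
theorem IsStationary.hasSum_wold {x : ℤ → E} (hx : IsStationary x)
    (hnd : PurelyNondeterministic x) (hpos : 0 < ‖innovation x 0‖)
    (hψ : Summable fun j => |maCoeff x j|) (t : ℤ) :
    HasSum (fun j : ℕ => maCoeff x j • innovation x (t - j)) (x t) := by
  have hsum : Summable (fun j : ℕ => maCoeff x j • innovation x (t - j)) := by
    refine Summable.of_norm ?_
    simp only [hx.norm_smul_innovation]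
    exact hψ.mul_right _
  obtain ⟨s, hs⟩ := hsum
  have hlim := tendsto_const_nhds (x := x t).sub hs.tendsto_sum_nat
  -- The remainders eventually lie in each closed past, hence so does their limit.
  have hzero : x t - s = 0 := by
    have hnd' : ⨅ n : ℤ, closedSpan x (Set.Iic n) = ⊥ := hnd
    rw [← Submodule.mem_bot ℝ, ← hnd', Submodule.mem_iInf]
    intro n
    refine (isClosed_closedSpan x _).mem_of_tendsto hlim ?_
    filter_upwards [eventually_ge_atTop (t - n).toNat] with m hm
    exact closedSpan_mono x (Set.Iic_subset_Iic.2 (by omega)) (hx.sub_sum_maCoeff_mem hpos t m)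
  rw [sub_eq_zero.1 hzero]
  exact hs

end

/-! ### Cauchy products, weighted ℓ¹ sequences and correlations -/

section

/-- The Cauchy product of two real sequences. -/
def cauchyProd (a b : ℕ → ℝ) (m : ℕ) : ℝ :=
  ∑ p ∈ Finset.HasAntidiagonal.antidiagonal m, a p.1 * b p.2

/-- Boundedness of `v` makes the double family absolutely summable; the two expansions are its sums
by rows and by antidiagonals. A general `F` covers both vectors and scalar sequences. -/
theorem hasSum_cauchyProd_smul {F : Type*} [NormedAddCommGroup F] [NormedSpace ℝ F]
    [CompleteSpace F] {a b : ℕ → ℝ} (ha : Summable fun j => |a j|)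
    (hb : Summable fun j => |b j|) {v u : ℕ → F} {C : ℝ} (hv : ∀ i, ‖v i‖ ≤ C)
    (hu : ∀ j, HasSum (fun l => b l • v (j + l)) (u j)) :
    ∃ s, HasSum (fun j => a j • u j) s ∧ HasSum (fun m => cauchyProd a b m • v m) s := by
  set G : ℕ × ℕ → F := fun p => (a p.1 * b p.2) • v (p.1 + p.2) with hG
  have hsum : Summable G := by
    refine Summable.of_norm_bounded
      ((ha.mul_of_nonneg hb (fun _ => abs_nonneg _) fun _ => abs_nonneg _).mul_right C) fun p => ?_
    rw [hG, norm_smul, Real.norm_eq_abs, abs_mul]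
    gcongr
    exact hv _
  obtain ⟨s, hs⟩ := hsum
  refine ⟨s, hs.prod_fiberwise fun j => ?_, ?_⟩
  · simpa only [hG, mul_smul] using (hu j).const_smul (a j)
  · have h2 := (Finset.HasAntidiagonal.sigmaAntidiagonalEquivProd (A := ℕ)).hasSum_iff.2 hs
    refine h2.sigma fun m => ?_
    have h3 := hasSum_fintype fun p : Finset.HasAntidiagonal.antidiagonal m =>
      (G ∘ Finset.HasAntidiagonal.sigmaAntidiagonalEquivProd (A := ℕ)) ⟨m, p⟩
    convert h3 using 1
    rw [cauchyProd, Finset.sum_smul, ← Finset.sum_coe_sort]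
    refine Finset.sum_congr rfl fun p _ => ?_
    have : p.1.1 + p.1.2 = m := Finset.HasAntidiagonal.mem_antidiagonal.1 p.2
    simp [hG, this]

theorem one_add_rpow_nonneg (β : ℝ) (j : ℕ) : 0 ≤ (1 + (j : ℝ)) ^ β :=
  Real.rpow_nonneg (by positivity) _

theorem _root_.MemCPlus.mono {α β : ℝ} (h : β ≤ α) {a : ℕ → ℝ} (ha : MemCPlus α a) :
    MemCPlus β a := by
  refine Summable.of_nonneg_of_le
    (fun j => mul_nonneg (one_add_rpow_nonneg _ _) (abs_nonneg _)) (fun j => ?_) ha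
  exact mul_le_mul_of_nonneg_right
    (Real.rpow_le_rpow_of_exponent_le (by simp) h) (abs_nonneg _)

theorem _root_.MemCPlus.summable_abs {α : ℝ} (h : 0 ≤ α) {a : ℕ → ℝ} (ha : MemCPlus α a) :
    Summable fun j => |a j| := by
  simpa [MemCPlus] using ha.mono h

/-- The weight is submultiplicative, since 1 + i + j ≤ (1 + i)(1 + j). -/
theorem _root_.MemCPlus.cauchyProd {β : ℝ} (hβ : 0 ≤ β) {a b : ℕ → ℝ} (ha : MemCPlus β a)
    (hb : MemCPlus β b) : MemCPlus β (StationarySequence.cauchyProd a b) := by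
  have ha' : Summable fun j : ℕ => (1 + (j : ℝ)) ^ β * |a j| := ha
  have hb' : Summable fun j : ℕ => (1 + (j : ℝ)) ^ β * |b j| := hb
  have hnn : ∀ c : ℕ → ℝ, 0 ≤ fun j : ℕ => (1 + (j : ℝ)) ^ β * |c j| := fun c j =>
    mul_nonneg (one_add_rpow_nonneg _ _) (abs_nonneg _)
  have hab : Summable fun p : ℕ × ℕ =>
      ((1 + (p.1 : ℝ)) ^ β * |a p.1|) * ((1 + (p.2 : ℝ)) ^ β * |b p.2|) :=
    ha'.mul_of_nonneg hb' (hnn a) (hnn b)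
  have h := summable_sum_mul_antidiagonal_of_summable_mul
    (f := fun j : ℕ => (1 + (j : ℝ)) ^ β * |a j|) (g := fun j : ℕ => (1 + (j : ℝ)) ^ β * |b j|) hab
  refine Summable.of_nonneg_of_le
    (fun j => mul_nonneg (one_add_rpow_nonneg _ _) (abs_nonneg _)) (fun m => ?_) h
  refine (mul_le_mul_of_nonneg_left (Finset.abs_sum_le_sum_abs _ _)
    (one_add_rpow_nonneg _ _)).trans ?_
  rw [Finset.mul_sum]
  refine Finset.sum_le_sum fun p hp => ?_
  rw [abs_mul]
  have hm : (1 + (m : ℝ)) ^ β ≤ (1 + (p.1 : ℝ)) ^ β * (1 + (p.2 : ℝ)) ^ β := by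
    rw [← Real.mul_rpow (by positivity) (by positivity)]
    refine Real.rpow_le_rpow (by positivity) ?_ hβ
    rw [← Finset.HasAntidiagonal.mem_antidiagonal.1 hp]
    push_cast
    nlinarith [mul_nonneg (Nat.cast_nonneg (α := ℝ) p.1) (Nat.cast_nonneg (α := ℝ) p.2)]
  calc _ ≤ ((1 + (p.1 : ℝ)) ^ β * (1 + (p.2 : ℝ)) ^ β) * (|a p.1| * |b p.2|) :=
        mul_le_mul_of_nonneg_right hm (by positivity)
    _ = _ := by ring

/-- The tail of a weighted summable sequence decays at the rate of the weight. -/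
theorem _root_.MemCPlus.tail_isLittleO {β : ℝ} (hβ : 0 ≤ β) {a : ℕ → ℝ} (ha : MemCPlus β a) :
    (fun n : ℕ => ∑' i : ℕ, |a (n + i)|) =o[atTop] fun n : ℕ => (n : ℝ) ^ (-β) := by
  have htail := tendsto_sum_nat_add fun j : ℕ => (1 + (j : ℝ)) ^ β * |a j|
  refine IsLittleO.of_bound fun c hc => ?_
  filter_upwards [htail.eventually (eventually_lt_nhds hc), eventually_gt_atTop 0] with n hn hn0
  have hn' : (0 : ℝ) < n := by exact_mod_cast hn0
  have hs : Summable fun i => (1 + ((i + n : ℕ) : ℝ)) ^ β * |a (i + n)| :=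
    (summable_nat_add_iff n).2 ha
  have hs' : Summable fun i => |a (n + i)| := by
    simpa only [add_comm] using (summable_nat_add_iff n).2 (ha.summable_abs hβ)
  have hle : (n : ℝ) ^ β * ∑' i : ℕ, |a (n + i)| ≤
      ∑' i, (1 + ((i + n : ℕ) : ℝ)) ^ β * |a (i + n)| := by
    rw [← tsum_mul_left]
    refine (hs'.mul_left _).tsum_le_tsum (fun i => ?_) hs
    rw [add_comm n i]
    refine mul_le_mul_of_nonneg_right (Real.rpow_le_rpow hn'.le ?_ hβ) (abs_nonneg _)
    push_cast
    linarith [(Nat.cast_nonneg i : (0 : ℝ) ≤ i)]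
  rw [Real.norm_of_nonneg (tsum_nonneg fun _ => abs_nonneg _),
    Real.norm_of_nonneg (Real.rpow_nonneg hn'.le _), Real.rpow_neg hn'.le, ← div_eq_mul_inv,
    le_div_iff₀ (Real.rpow_pos_of_pos hn' _), mul_comm]
  exact hle.trans hn.le

theorem summable_mul_comp_add {a f : ℕ → ℝ} (ha0 : ∀ j, 0 ≤ a j) (hf0 : ∀ j, 0 ≤ f j)
    (ha : Summable a) (hf : Summable f) : Summable fun p : ℕ × ℕ => a p.1 * f (p.1 + p.2) := by
  have h0 : 0 ≤ fun p : ℕ × ℕ => a p.1 * f (p.1 + p.2) := fun p => mul_nonneg (ha0 _) (hf0 _)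
  have hs : ∀ j, Summable fun l => f (j + l) := fun j => hf.comp_injective (add_right_injective j)
  have hs' : ∀ j, Summable fun l => a j * f (j + l) := fun j => (hs j).mul_left _
  have hle : ∀ j, ∑' l, a j * f (j + l) ≤ a j * ∑' l, f l := fun j => by
    rw [tsum_mul_left]
    exact mul_le_mul_of_nonneg_left
      (tsum_comp_le_tsum_of_inj hf hf0 (add_right_injective j)) (ha0 j)
  have hsum : Summable fun j => ∑' l, a j * f (j + l) :=
    Summable.of_nonneg_of_le (fun j => tsum_nonneg fun l => h0 (j, l)) hle (ha.mul_right _)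
  exact (summable_prod_of_nonneg h0).2 ⟨hs', hsum⟩

/-- Correlating an absolutely summable sequence with a weighted summable one. -/
theorem _root_.MemCPlus.summable_correlation {β : ℝ} (hβ : 0 ≤ β) {a b : ℕ → ℝ}
    (ha : Summable fun j => |a j|) (hb : MemCPlus β b) :
    Summable fun p : ℕ × ℕ => (1 + (p.2 : ℝ)) ^ β * (|a p.1| * |b (p.1 + p.2)|) := by
  have h := summable_mul_comp_add (a := fun j => |a j|)
    (f := fun j : ℕ => (1 + (j : ℝ)) ^ β * |b j|) (fun j => abs_nonneg _)
    (fun j => mul_nonneg (one_add_rpow_nonneg _ _) (abs_nonneg _)) ha hb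
  refine Summable.of_nonneg_of_le
    (fun p => mul_nonneg (one_add_rpow_nonneg _ _) (by positivity)) (fun p => ?_) h
  rw [mul_left_comm]
  refine mul_le_mul_of_nonneg_left (mul_le_mul_of_nonneg_right
    (Real.rpow_le_rpow (by positivity) ?_ hβ) (abs_nonneg _)) (abs_nonneg _)
  push_cast
  linarith [(Nat.cast_nonneg p.1 : (0 : ℝ) ≤ p.1)]

/-- Correlating a bounded sequence costs one power of the weight. -/
theorem _root_.MemCPlus.summable_correlation_of_bounded {β : ℝ} (hβ : 0 ≤ β) {a b : ℕ → ℝ} {C : ℝ}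
    (ha : ∀ j, |a j| ≤ C) (hb : MemCPlus (β + 1) b) :
    Summable fun p : ℕ × ℕ => (1 + (p.2 : ℝ)) ^ β * (|a p.1| * |b (p.1 + p.2)|) := by
  have hC : 0 ≤ C := (abs_nonneg _).trans (ha 0)
  have hnn : ∀ p : ℕ × ℕ, 0 ≤ (1 + (p.2 : ℝ)) ^ β * (|a p.1| * |b (p.1 + p.2)|) := fun p =>
    mul_nonneg (one_add_rpow_nonneg _ _) (by positivity)
  set e := Finset.HasAntidiagonal.sigmaAntidiagonalEquivProd (A := ℕ) with he
  rw [← e.summable_iff]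
  have hnn' : 0 ≤ (fun p : ℕ × ℕ => (1 + (p.2 : ℝ)) ^ β * (|a p.1| * |b (p.1 + p.2)|)) ∘ e :=
    fun p => hnn (e p)
  refine (summable_sigma_of_nonneg hnn').2 ⟨fun m => Summable.of_finite, ?_⟩
  refine Summable.of_nonneg_of_le (fun m => tsum_nonneg fun p => hnn' _) (fun m => ?_)
    (Summable.mul_left C hb)
  rw [tsum_fintype]
  have hterm : ∀ p : Finset.HasAntidiagonal.antidiagonal m,
      ((fun p : ℕ × ℕ => (1 + (p.2 : ℝ)) ^ β * (|a p.1| * |b (p.1 + p.2)|)) ∘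
        e) ⟨m, p⟩ ≤ (1 + (m : ℝ)) ^ β * (C * |b m|) := by
    rintro ⟨p, hp⟩
    have hpm : p.1 + p.2 = m := Finset.HasAntidiagonal.mem_antidiagonal.1 hp
    simp only [he, Function.comp_apply, Finset.HasAntidiagonal.sigmaAntidiagonalEquivProd_apply,
      hpm]
    refine mul_le_mul (Real.rpow_le_rpow (by positivity) ?_ hβ)
      (mul_le_mul_of_nonneg_right (ha _) (abs_nonneg _)) (by positivity) (one_add_rpow_nonneg _ _)
    have : p.2 ≤ m := by omega
    have : (p.2 : ℝ) ≤ m := by exact_mod_cast this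
    linarith
  refine (Finset.sum_le_sum fun p _ => hterm p).trans (le_of_eq ?_)
  -- The `m + 1` pairs on the antidiagonal supply the extra factor that raises the exponent to `β +
  -- 1`.
  rw [Finset.sum_const, Finset.card_univ, Fintype.card_coe, Finset.Nat.card_antidiagonal,
    nsmul_eq_mul, Real.rpow_add (by positivity), Real.rpow_one]
  push_cast
  ring

/-! ### Autoregressive inversion and the Riesz bound -/

variable {E : Type*} [NormedAddCommGroup E] [InnerProductSpace ℝ E] [CompleteSpace E]

/-- The constant coefficient 1 makes the power series inverse a true inverse; the sign convention
φ_0 = -1 produces the -1. -/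
theorem cauchyProd_arCoeff_maCoeff {x : ℤ → E} (h0 : maCoeff x 0 = 1) (m : ℕ) :
    cauchyProd (arCoeff x) (maCoeff x) m = if m = 0 then -1 else 0 := by
  have hinv : (PowerSeries.mk (maCoeff x))⁻¹ * PowerSeries.mk (maCoeff x) = 1 :=
    PowerSeries.inv_mul_cancel _ (by
      rw [← PowerSeries.coeff_zero_eq_constantCoeff_apply, PowerSeries.coeff_mk, h0]
      exact one_ne_zero)
  have := congrArg (PowerSeries.coeff m) hinv
  rw [PowerSeries.coeff_mul, PowerSeries.coeff_one] at this
  simp only [PowerSeries.coeff_mk] at this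
  simp only [cauchyProd, arCoeff, neg_mul, Finset.sum_neg_distrib, this]
  split_ifs <;> simp

/-- A standing package: a stationary sequence with absolutely summable Wold and autoregressive
coefficients and nonzero innovations. -/
structure HasSummableCoeffs (x : ℤ → E) : Prop where
  stationary : IsStationary x
  nondet : PurelyNondeterministic x
  pos : 0 < ‖innovation x 0‖
  ma : Summable fun j => |maCoeff x j|
  ar : Summable fun j => |arCoeff x j|

/-- If `u = Ψ(S) v` for the forward shift `S` then `v = -Φ(S) u`. -/
theorem HasSummableCoeffs.hasSum_arCoeff_smul {x : ℤ → E} (hx : HasSummableCoeffs x) {F : Type*}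
    [NormedAddCommGroup F] [NormedSpace ℝ F] [CompleteSpace F] {v u : ℕ → F} {C : ℝ}
    (hv : ∀ i, ‖v i‖ ≤ C) (hu : ∀ j, HasSum (fun l => maCoeff x l • v (j + l)) (u j)) :
    HasSum (fun j => arCoeff x j • u j) (-v 0) := by
  obtain ⟨s, hs, hs'⟩ := hasSum_cauchyProd_smul hx.ar hx.ma hv hu
  have h1 : HasSum (fun m => cauchyProd (arCoeff x) (maCoeff x) m • v m)
      (cauchyProd (arCoeff x) (maCoeff x) 0 • v 0) := by
    refine hasSum_single 0 fun m hm => ?_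
    rw [cauchyProd_arCoeff_maCoeff (hx.stationary.maCoeff_zero hx.pos), if_neg hm, zero_smul]
  rw [cauchyProd_arCoeff_maCoeff (hx.stationary.maCoeff_zero hx.pos), if_pos rfl, neg_one_smul]
    at h1
  rwa [← hs'.unique h1]

theorem HasSummableCoeffs.hasSum_wold {x : ℤ → E} (hx : HasSummableCoeffs x) (t : ℤ) :
    HasSum (fun j : ℕ => maCoeff x j • innovation x (t - j)) (x t) :=
  hx.stationary.hasSum_wold hx.nondet hx.pos hx.ma t

/-- The infinite-order autoregressive representation. -/
theorem HasSummableCoeffs.hasSum_ar {x : ℤ → E} (hx : HasSummableCoeffs x) (t : ℤ) :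
    HasSum (fun j : ℕ => arCoeff x j • x (t - j)) (-innovation x t) := by
  have := hx.hasSum_arCoeff_smul (v := fun i : ℕ => innovation x (t - i))
    (u := fun j : ℕ => x (t - j)) (C := ‖innovation x 0‖)
    (fun i => (hx.stationary.norm_innovation _).le) fun j => by
      have := hx.hasSum_wold (t - j)
      simpa only [Nat.cast_add, sub_add_eq_sub_sub] using this
  simpa using this

theorem HasSummableCoeffs.inner_innovation {x : ℤ → E} (hx : HasSummableCoeffs x) (t s : ℤ) :
    inner ℝ (x t) (innovation x s) =
      if s ≤ t then ‖innovation x 0‖ ^ 2 * maCoeff x (t - s).toNat else 0 := by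
  split_ifs with h
  · have := hx.stationary.inner_innovation_sub hx.pos t (t - s).toNat
    rwa [show t - ((t - s).toNat : ℤ) = s by omega] at this
  · exact inner_innovation_of_lt x (not_le.1 h)

theorem HasSummableCoeffs.norm_sum_innovation_sq {x : ℤ → E} (hx : HasSummableCoeffs x)
    {ι : Type*} {f : ι → ℤ} (hf : Function.Injective f) (c : ι → ℝ) (s : Finset ι) :
    ‖∑ k ∈ s, c k • innovation x (f k)‖ ^ 2 = ‖innovation x 0‖ ^ 2 * ∑ k ∈ s, c k ^ 2 := by
  classical
  induction s using Finset.induction_on with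
  | empty => simp
  | insert a s ha ih =>
    have horth : inner ℝ (c a • innovation x (f a)) (∑ k ∈ s, c k • innovation x (f k)) = 0 := by
      rw [inner_sum]
      refine Finset.sum_eq_zero fun k hk => ?_
      rw [inner_smul_left, inner_smul_right, inner_innovation_innovation, mul_zero, mul_zero]
      exact fun h => ha (hf h ▸ hk)
    rw [Finset.sum_insert ha, Finset.sum_insert ha, norm_add_sq_real, horth, ih,
      hx.stationary.norm_smul_innovation, mul_pow, sq_abs]
    ring

/-- The upper Riesz bound. -/
theorem HasSummableCoeffs.norm_sum_le {x : ℤ → E} (hx : HasSummableCoeffs x)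
    {ι : Type*} {f : ι → ℤ} (hf : Function.Injective f) (c : ι → ℝ) (s : Finset ι) :
    ‖∑ k ∈ s, c k • x (f k)‖ ≤
      (∑' j, |maCoeff x j|) * (‖innovation x 0‖ * √(∑ k ∈ s, c k ^ 2)) := by
  -- Exchanging the sums gives a ψ-weighted series of delayed innovation combinations, which all
  -- have the same norm by orthogonality.
  have h : HasSum (fun j : ℕ => maCoeff x j • ∑ k ∈ s, c k • innovation x (f k - j))
      (∑ k ∈ s, c k • x (f k)) := by
    have := hasSum_sum (s := s) fun k (_ : k ∈ s) => (hx.hasSum_wold (f k)).const_smul (c k)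
    refine this.congr_fun ?_
    intro j
    rw [Finset.smul_sum]
    exact Finset.sum_congr rfl fun k _ => smul_comm _ _ _
  have hb := hx.ma.hasSum.mul_right (‖innovation x 0‖ * √(∑ k ∈ s, c k ^ 2))
  rw [← h.tsum_eq]
  refine tsum_of_norm_bounded hb fun j => ?_
  rw [norm_smul, Real.norm_eq_abs]
  refine mul_le_mul_of_nonneg_left ?_ (abs_nonneg _)
  refine le_of_sq_le_sq ?_ (by positivity)
  rw [hx.norm_sum_innovation_sq (f := fun k => f k - j)
    (fun a b hab => hf (by simpa using hab)), mul_pow, Real.sq_sqrt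
      (Finset.sum_nonneg fun _ _ => sq_nonneg _)]

/-- The Riesz bound transfers the Cauchy criterion from `∑ c k ^ 2` to the vector series. -/
theorem HasSummableCoeffs.summable_smul {x : ℤ → E} (hx : HasSummableCoeffs x)
    {ι : Type*} {f : ι → ℤ} (hf : Function.Injective f) {c : ι → ℝ}
    (hc : Summable fun k => c k ^ 2) : Summable fun k => c k • x (f k) := by
  rw [summable_iff_vanishing_norm]
  intro ε hε
  set D := (∑' j, |maCoeff x j|) * ‖innovation x 0‖ + 1 with hD
  have hA : 0 ≤ (∑' j, |maCoeff x j|) * ‖innovation x 0‖ :=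
    mul_nonneg (tsum_nonneg fun _ => abs_nonneg _) (norm_nonneg _)
  obtain ⟨s, hs⟩ := summable_iff_vanishing_norm.1 hc ((ε / D) ^ 2) (by positivity)
  refine ⟨s, fun t ht => ?_⟩
  have h1 := hs t ht
  rw [Real.norm_of_nonneg (Finset.sum_nonneg fun _ _ => sq_nonneg _)] at h1
  have h2 : √(∑ k ∈ t, c k ^ 2) < ε / D := (Real.sqrt_lt' (by positivity)).2 h1
  calc _ ≤ _ := hx.norm_sum_le hf c t
    _ ≤ D * √(∑ k ∈ t, c k ^ 2) := by
        rw [← mul_assoc]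
        exact mul_le_mul_of_nonneg_right (by linarith) (Real.sqrt_nonneg _)
    _ < D * (ε / D) := mul_lt_mul_of_pos_left h2 (by positivity)
    _ = ε := mul_div_cancel₀ ε (by positivity)

end

/-! ### Autocovariance, Toeplitz operators and Baxter's inequality -/

section

/-- Minkowski's inequality for a family of weighted series. -/
theorem sum_abs_le_tsum_of_hasSum {ι : Type*} {s : Finset ι} {a B : ℕ → ℝ} {f : ι → ℕ → ℝ}
    {d : ι → ℝ} (hd : ∀ i ∈ s, HasSum (fun j => a j * f i j) (d i))
    (hB : ∀ j, ∑ i ∈ s, |f i j| ≤ B j) (hs : Summable fun j => |a j| * B j) :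
    ∑ i ∈ s, |d i| ≤ ∑' j, |a j| * B j := by
  -- Weighting each series by the sign of its sum produces a single series that can be bounded
  -- termwise.
  have h1 := hasSum_sum fun i hi => (hd i hi).mul_left (SignType.sign (d i) : ℝ)
  have h2 : ∑ i ∈ s, (SignType.sign (d i) : ℝ) * d i = ∑ i ∈ s, |d i| :=
    Finset.sum_congr rfl fun i _ => sign_mul_self _
  rw [h2] at h1
  refine (le_abs_self _).trans ?_
  rw [← Real.norm_eq_abs, ← h1.tsum_eq]
  refine tsum_of_norm_bounded hs.hasSum fun j => ?_
  refine (norm_sum_le _ _).trans (le_trans ?_ (mul_le_mul_of_nonneg_left (hB j) (abs_nonneg _)))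
  rw [Finset.mul_sum]
  refine Finset.sum_le_sum fun i _ => ?_
  rw [norm_mul, Real.norm_eq_abs, Real.norm_eq_abs, abs_mul]
  have : |(SignType.sign (d i) : ℝ)| ≤ 1 := by
    rcases lt_trichotomy (d i) 0 with h | h | h <;> simp [h]
  exact mul_le_of_le_one_left (by positivity) this

variable {E : Type*} [NormedAddCommGroup E] [InnerProductSpace ℝ E]

/-- The autocovariance function. -/
def autocov (x : ℤ → E) (k : ℤ) : ℝ := inner ℝ (x 0) (x k)

theorem IsStationary.inner_eq_autocov {x : ℤ → E} (hx : IsStationary x) (s t : ℤ) :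
    inner ℝ (x s) (x t) = autocov x (t - s) := by
  have := hx 0 (t - s) s
  rwa [zero_add, sub_add_cancel] at this

theorem IsStationary.autocov_neg {x : ℤ → E} (hx : IsStationary x) (k : ℤ) :
    autocov x (-k) = autocov x k := by
  rw [← zero_sub, ← hx.inner_eq_autocov, real_inner_comm, autocov]

/-- The Toeplitz operator of the autocovariance applied to the window `[0, n)` of `d`. -/
def toeplitz (x : ℤ → E) (n : ℤ) (d : ℤ → ℝ) (i : ℤ) : ℝ :=
  ∑ j ∈ Finset.Ico 0 n, d j * autocov x (j - i)

/-- The autocovariance is even. This carries estimates near one end of the window over to the other.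
-/
theorem IsStationary.toeplitz_reflect {x : ℤ → E} (hx : IsStationary x) (n : ℤ) (d : ℤ → ℝ)
    (i : ℤ) : toeplitz x n (fun j => d (n - 1 - j)) i = toeplitz x n d (n - 1 - i) := by
  refine Finset.sum_nbij' (fun j => n - 1 - j) (fun j => n - 1 - j) ?_ ?_ ?_ ?_ ?_
  · intro j hj; rw [Finset.mem_Ico] at hj ⊢; omega
  · intro j hj; rw [Finset.mem_Ico] at hj ⊢; omega
  · intro j _; ring
  · intro j _; ring
  · intro j _
    rw [← hx.autocov_neg]
    congr 2; ring

variable [CompleteSpace E]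

theorem HasSummableCoeffs.hasSum_autocov {x : ℤ → E} (hx : HasSummableCoeffs x) (p : ℕ) :
    HasSum (fun j => ‖innovation x 0‖ ^ 2 * (maCoeff x j * maCoeff x (j + p)))
      (autocov x p) := by
  have h := (hx.hasSum_wold 0).mapL (innerSL ℝ (x p))
  simp only [innerSL_apply_apply, inner_smul_right, hx.inner_innovation] at h
  rw [real_inner_comm] at h
  refine h.congr_fun fun j => ?_
  rw [if_pos (by omega), show ((p : ℤ) - (0 - j)).toNat = j + p by omega]
  ring

/-- Up to ‖ε₀‖² the autocovariance is the correlation of ψ with itself, and correlating with a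
summable sequence preserves the weight. -/
theorem HasSummableCoeffs.memCPlus_autocov {x : ℤ → E} (hx : HasSummableCoeffs x) {β : ℝ}
    (hβ : 0 ≤ β) (hψ : MemCPlus β (maCoeff x)) : MemCPlus β fun p : ℕ => autocov x p := by
  have h := MemCPlus.summable_correlation hβ hx.ma hψ
  have h' := (h.prod_symm.prod).mul_left (‖innovation x 0‖ ^ 2)
  refine Summable.of_nonneg_of_le
    (fun j => mul_nonneg (one_add_rpow_nonneg _ _) (abs_nonneg _)) (fun p => ?_) h'
  show (1 + (p : ℝ)) ^ β * |autocov x p| ≤ _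
  rw [← (hx.hasSum_autocov p).tsum_eq]
  have hs : Summable fun j => (1 + (p : ℝ)) ^ β * (|maCoeff x j| * |maCoeff x (j + p)|) :=
    h.prod_symm.prod_factor p
  have h0 : (1 + (p : ℝ)) ^ β ≠ 0 := (Real.rpow_pos_of_pos (by positivity) _).ne'
  have hs' : Summable fun j => |maCoeff x j| * |maCoeff x (j + p)| :=
    (summable_mul_left_iff h0).1 hs
  rw [tsum_mul_left, abs_mul, abs_of_nonneg (sq_nonneg _)]
  have hle : |∑' j, maCoeff x j * maCoeff x (j + p)| ≤
      ∑' j, |maCoeff x j| * |maCoeff x (j + p)| := by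
    rw [← Real.norm_eq_abs]
    exact tsum_of_norm_bounded hs'.hasSum fun j => by rw [Real.norm_eq_abs, abs_mul]
  calc _ ≤ (1 + (p : ℝ)) ^ β * (‖innovation x 0‖ ^ 2 *
          ∑' j, |maCoeff x j| * |maCoeff x (j + p)|) :=
        mul_le_mul_of_nonneg_left (mul_le_mul_of_nonneg_left hle (sq_nonneg _))
          (one_add_rpow_nonneg _ _)
    _ = ‖innovation x 0‖ ^ 2 * ∑' j, (1 + (p : ℝ)) ^ β *
          (|maCoeff x j| * |maCoeff x (j + p)|) := by rw [tsum_mul_left]; ring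
    _ = _ := rfl

theorem HasSummableCoeffs.summable_abs_autocov {x : ℤ → E} (hx : HasSummableCoeffs x) :
    Summable fun k : ℤ => |autocov x k| := by
  have h : Summable fun p : ℕ => |autocov x p| :=
    (hx.memCPlus_autocov le_rfl (by simpa [MemCPlus] using hx.ma)).summable_abs le_rfl
  refine Summable.of_nat_of_neg h ?_
  simpa only [hx.stationary.autocov_neg] using h

theorem HasSummableCoeffs.sum_abs_autocov_le {x : ℤ → E} (hx : HasSummableCoeffs x)
    {ι : Type*} {f : ι → ℤ} (hf : Function.Injective f) (s : Finset ι) :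
    ∑ i ∈ s, |autocov x (f i)| ≤ ∑' k, |autocov x k| := by
  have h := hx.summable_abs_autocov
  exact ((h.comp_injective hf).sum_le_tsum s fun _ _ => abs_nonneg _).trans
    (tsum_comp_le_tsum_of_inj h (fun _ => abs_nonneg _) hf)

/-- Young's inequality. The indices `f i` may leave the window, as they do in `sum_abs_Ico_le`. -/
theorem HasSummableCoeffs.sum_abs_toeplitz_le {x : ℤ → E} (hx : HasSummableCoeffs x) (n : ℤ)
    (d : ℤ → ℝ) {f : ℤ → ℤ} (hf : Function.Injective f) (s : Finset ℤ) :
    ∑ i ∈ s, |toeplitz x n d (f i)| ≤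
      (∑' k, |autocov x k|) * ∑ j ∈ Finset.Ico 0 n, |d j| := by
  calc _ ≤ ∑ i ∈ s, ∑ j ∈ Finset.Ico 0 n, |d j| * |autocov x (j - f i)| :=
        Finset.sum_le_sum fun i _ => (Finset.abs_sum_le_sum_abs _ _).trans
          (le_of_eq (Finset.sum_congr rfl fun j _ => abs_mul _ _))
    _ = ∑ j ∈ Finset.Ico 0 n, |d j| * ∑ i ∈ s, |autocov x (j - f i)| := by
        rw [Finset.sum_comm]
        exact Finset.sum_congr rfl fun j _ => (Finset.mul_sum _ _ _).symm
    _ ≤ ∑ j ∈ Finset.Ico 0 n, |d j| * ∑' k, |autocov x k| :=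
        Finset.sum_le_sum fun j _ => mul_le_mul_of_nonneg_left
          (hx.sum_abs_autocov_le (f := fun i => j - f i) (fun a b h => hf (by simpa using h)) s)
          (abs_nonneg _)
    _ = _ := by rw [← Finset.sum_mul, mul_comm]

/-- One factor of the Wiener–Hopf factorization of the Toeplitz operator, up to `‖ε₀‖²`. -/
theorem HasSummableCoeffs.hasSum_maCoeff_window {x : ℤ → E} (hx : HasSummableCoeffs x) {n : ℤ}
    {d : ℤ → ℝ} (hd : ∀ i ∉ Finset.Ico 0 n, d i = 0) (i : ℤ) :
    HasSum (fun l : ℕ => maCoeff x l • d (i + l))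
      ((∑ j ∈ Finset.Ico 0 n, d j * inner ℝ (x j) (innovation x i)) / ‖innovation x 0‖ ^ 2) := by
  have h0 := hx.pos
  have h1 : ∀ j ∈ Finset.Ico 0 n, HasSum
      (fun l : ℕ => maCoeff x l • if i + l = j then d j else 0)
      (d j * inner ℝ (x j) (innovation x i) / ‖innovation x 0‖ ^ 2) := by
    intro j _
    rw [hx.inner_innovation]
    split_ifs with h
    · have h2 := hasSum_single (f := fun l : ℕ => maCoeff x l • if i + l = j then d j else 0)
        (j - i).toNat fun l hl => by
          rw [if_neg (by omega), smul_zero]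
      convert h2 using 1
      rw [if_pos (by omega), smul_eq_mul]
      field_simp
    · rw [mul_zero, zero_div]
      refine hasSum_zero.congr_fun fun l => ?_
      rw [if_neg (by omega), smul_zero]
  have h2 := hasSum_sum h1
  rw [← Finset.sum_div] at h2
  refine h2.congr_fun fun l => ?_
  rw [← Finset.smul_sum]
  congr 1
  rw [Finset.sum_ite_eq]
  split_ifs with h
  · rfl
  · exact hd _ h

theorem hasSum_tail_indicator {a : ℕ → ℝ} (ha : Summable a) (N : ℕ) :
    HasSum (fun k => if N ≤ k then a k else 0) (∑' k, a (N + k)) := by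
  rw [← hasSum_nat_add_iff' N, Finset.sum_eq_zero, sub_zero]
  · simp only [le_add_iff_nonneg_left, zero_le, if_true, add_comm N]
    exact ((summable_nat_add_iff N).2 ha).hasSum
  · intro k hk
    rw [if_neg (by simpa using hk)]

/-- Inverting the Toeplitz matrix away from one end of the window. -/
theorem HasSummableCoeffs.sum_abs_Ico_le {x : ℤ → E} (hx : HasSummableCoeffs x) (n : ℤ) (N : ℕ)
    {d : ℤ → ℝ} (hd : ∀ i ∉ Finset.Ico 0 n, d i = 0) :
    ∑ i ∈ Finset.Ico (N : ℤ) n, |d i| ≤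
      (∑' k, |arCoeff x k|) * (((∑' k, |arCoeff x k|) * ∑ i ∈ Finset.Ico 0 n, |toeplitz x n d i| +
        (∑' k, |arCoeff x (N + k)|) * ((∑' k, |autocov x k|) * ∑ j ∈ Finset.Ico 0 n, |d j|)) /
        ‖innovation x 0‖ ^ 2) := by
  set A := ∑' k, |arCoeff x k| with hA
  set Y := ∑ i ∈ Finset.Ico 0 n, |toeplitz x n d i| with hY
  set D := ∑ j ∈ Finset.Ico 0 n, |d j| with hD
  set G := ∑' k, |autocov x k| with hG
  set w : ℤ → ℝ := fun i => ∑ j ∈ Finset.Ico 0 n, d j * inner ℝ (x j) (innovation x i) with hw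
  have hA0 : 0 ≤ A := tsum_nonneg fun _ => abs_nonneg _
  have hY0 : 0 ≤ Y := Finset.sum_nonneg fun _ _ => abs_nonneg _
  have hwz : ∀ i, n ≤ i → w i = 0 := fun i hi => Finset.sum_eq_zero fun j hj => by
    rw [inner_innovation_of_lt x ((Finset.mem_Ico.1 hj).2.trans_le hi), mul_zero]
  have hdb : ∀ i, |d i| ≤ D := fun i => by
    by_cases hi : i ∈ Finset.Ico 0 n
    · exact Finset.single_le_sum (f := fun j => |d j|) (fun _ _ => abs_nonneg _) hi
    · rw [hd i hi, abs_zero]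
      exact Finset.sum_nonneg fun _ _ => abs_nonneg _
  -- Here `w` is ‖ε₀‖² times Ψ of the forward shift applied to `d`, and -Φ undoes it.
  have hdw : ∀ i, HasSum (fun j => arCoeff x j * (w (i + j) / ‖innovation x 0‖ ^ 2)) (-d i) := by
    intro i
    have := hx.hasSum_arCoeff_smul (v := fun l : ℕ => d (i + l))
      (u := fun j : ℕ => w (i + j) / ‖innovation x 0‖ ^ 2) (C := D) (fun l => hdb _) fun j => by
        have := hx.hasSum_maCoeff_window hd (i + j)
        simpa only [Nat.cast_add, add_assoc] using this
    simpa using this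
  -- Pairing the AR representation of ε_i with ∑ d_j x_j expresses `w` through the Toeplitz output
  -- at indices up to `i`.
  have hwy : ∀ i, HasSum (fun k => arCoeff x k * toeplitz x n d (i - k)) (-w i) := by
    intro i
    have h := (hx.hasSum_ar i).mapL (innerSL ℝ (∑ j ∈ Finset.Ico 0 n, d j • x j))
    simp only [innerSL_apply_apply, inner_smul_right, inner_neg_right, sum_inner,
      real_inner_smul_left] at h
    refine h.congr_fun fun k => ?_
    simp only [toeplitz, hx.stationary.inner_eq_autocov]
    congr 1
    refine Finset.sum_congr rfl fun j _ => ?_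
    rw [← hx.stationary.autocov_neg, neg_sub]
  -- For `k < N` the shift by `k` keeps `[N, n)` inside the window, at cost `Y`. For `k ≥ N` it may
  -- leave the window; the crude bound `G * D` then enters, weighted by a tail of φ.
  have hW : ∑ i ∈ Finset.Ico (N : ℤ) n, |w i| ≤
      A * Y + (∑' k, |arCoeff x (N + k)|) * (G * D) := by
    have hterm : HasSum (fun k => |arCoeff x k| * (Y + if N ≤ k then G * D else 0))
        (A * Y + (∑' k, |arCoeff x (N + k)|) * (G * D)) := by
      have := (hx.ar.hasSum.mul_right Y).add
        ((hasSum_tail_indicator hx.ar N).mul_right (G * D))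
      refine this.congr_fun fun k => ?_
      split_ifs <;> ring
    rw [← hterm.tsum_eq]
    have := sum_abs_le_tsum_of_hasSum (s := Finset.Ico (N : ℤ) n) (fun i _ => hwy i)
      (B := fun k => Y + if N ≤ k then G * D else 0) (fun k => ?_) hterm.summable
    · simpa only [abs_neg] using this
    · split_ifs with hk
      · have := hx.sum_abs_toeplitz_le n d (f := fun i => i - k)
          (fun a b h => by simpa using h) (Finset.Ico (N : ℤ) n)
        exact this.trans (le_add_of_nonneg_left hY0)
      · rw [add_zero, hY]
        have himg : ((Finset.Ico (N : ℤ) n).image fun i => i - (k : ℤ)) ⊆ Finset.Ico 0 n := by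
          intro m hm
          obtain ⟨i, hi, rfl⟩ := Finset.mem_image.1 hm
          rw [Finset.mem_Ico] at hi ⊢
          omega
        rw [← Finset.sum_image (f := fun m => |toeplitz x n d m|)
          (g := fun i : ℤ => i - (k : ℤ)) (fun a _ b _ h => by simpa using h)]
        exact Finset.sum_le_sum_of_subset_of_nonneg himg fun _ _ _ => abs_nonneg _
  have hfin := sum_abs_le_tsum_of_hasSum (s := Finset.Ico (N : ℤ) n) (fun i _ => hdw i)
    (B := fun _ => (A * Y + (∑' k, |arCoeff x (N + k)|) * (G * D)) / ‖innovation x 0‖ ^ 2)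
    (fun j => ?_) (hx.ar.mul_right _)
  · simpa only [abs_neg, tsum_mul_right] using hfin
  · simp only [abs_div, abs_of_nonneg (sq_nonneg ‖innovation x 0‖)]
    rw [← Finset.sum_div]
    refine div_le_div_of_nonneg_right (le_trans ?_ hW) (sq_nonneg _)
    -- Since `w` vanishes from `n` on, shifting right picks up no mass outside `[N, n)`.
    have himg : ∀ m ∈ ((Finset.Ico (N : ℤ) n).image fun i => i + (j : ℤ)),
        m ∉ Finset.Ico (N : ℤ) n → |w m| = 0 := by
      intro m hm hm'
      obtain ⟨i, hi, rfl⟩ := Finset.mem_image.1 hm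
      rw [Finset.mem_Ico] at hi hm'
      rw [hwz _ (by omega), abs_zero]
    rw [← Finset.sum_image (f := fun m => |w m|) (g := fun i : ℤ => i + (j : ℤ))
      (fun a _ b _ h => by simpa using h)]
    calc _ ≤ ∑ m ∈ (Finset.Ico (N : ℤ) n) ∪ ((Finset.Ico (N : ℤ) n).image fun i => i + (j : ℤ)),
          |w m| := Finset.sum_le_sum_of_subset_of_nonneg Finset.subset_union_right
            fun _ _ _ => abs_nonneg _
      _ = _ := (Finset.sum_subset Finset.subset_union_left fun m hm hm' =>
          himg m ((Finset.mem_union.1 hm).resolve_left hm') hm').symm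

theorem sum_Ico_reflect (n : ℤ) (f : ℤ → ℝ) :
    ∑ i ∈ Finset.Ico 0 n, f (n - 1 - i) = ∑ i ∈ Finset.Ico 0 n, f i := by
  refine Finset.sum_nbij' (fun j => n - 1 - j) (fun j => n - 1 - j) ?_ ?_ ?_ ?_ fun _ _ => rfl
  · intro j hj; rw [Finset.mem_Ico] at hj ⊢; omega
  · intro j hj; rw [Finset.mem_Ico] at hj ⊢; omega
  · intro j _; ring
  · intro j _; ring

/-- Baxter's inequality: the inverses of the Toeplitz matrices of the autocovariance are
eventually uniformly bounded for the `ℓ¹` norm. -/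
theorem HasSummableCoeffs.exists_baxter_bound {x : ℤ → E} (hx : HasSummableCoeffs x) :
    ∃ C : ℝ, 0 ≤ C ∧ ∀ᶠ n : ℕ in atTop, ∀ d : ℤ → ℝ, (∀ i ∉ Finset.Ico 0 (n : ℤ), d i = 0) →
      ∑ i ∈ Finset.Ico 0 (n : ℤ), |d i| ≤
        C * ∑ i ∈ Finset.Ico 0 (n : ℤ), |toeplitz x n d i| := by
  set A := ∑' k, |arCoeff x k| with hA
  set G := ∑' k, |autocov x k| with hG
  set τ : ℕ → ℝ := fun N => ∑' k, |arCoeff x (N + k)| with hτ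
  have hA0 : 0 ≤ A := tsum_nonneg fun _ => abs_nonneg _
  have hσ : 0 < ‖innovation x 0‖ ^ 2 := pow_pos hx.pos 2
  have hτ0 : Tendsto τ atTop (𝓝 0) := by
    have := tendsto_sum_nat_add fun j => |arCoeff x j|
    simpa only [hτ, add_comm] using this
  have hlim : Tendsto (fun n : ℕ => 2 * (A * (τ (n / 2) * G / ‖innovation x 0‖ ^ 2))) atTop
      (𝓝 0) := by
    have h2 : Tendsto (fun n : ℕ => n / 2) atTop atTop :=
      Nat.tendsto_div_const_atTop (by norm_num)
    simpa using (((hτ0.comp h2).mul_const G).div_const (‖innovation x 0‖ ^ 2)).const_mul A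
      |>.const_mul 2
  -- Each half of the window contributes one copy, and absorbing a `D` term with coefficient at most
  -- 1/2 doubles the total.
  refine ⟨4 * (A * (A / ‖innovation x 0‖ ^ 2)), by positivity, ?_⟩
  filter_upwards [hlim.eventually (eventually_le_nhds (by norm_num : (0 : ℝ) < 1 / 2))]
    with n hn d hd
  have hd' : ∀ i ∉ Finset.Ico 0 (n : ℤ), d (n - 1 - i) = 0 := fun i hi =>
    hd _ (by rw [Finset.mem_Ico] at hi ⊢; omega)
  have h1 := hx.sum_abs_Ico_le n (n / 2) hd
  have h2 := hx.sum_abs_Ico_le n (n / 2) hd'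
  simp only [hx.stationary.toeplitz_reflect] at h2
  rw [sum_Ico_reflect n fun i => |toeplitz x n d i|, sum_Ico_reflect n fun i => |d i|] at h2
  set Y := ∑ i ∈ Finset.Ico 0 (n : ℤ), |toeplitz x n d i| with hY
  set D := ∑ i ∈ Finset.Ico 0 (n : ℤ), |d i| with hD
  have hD0 : 0 ≤ D := Finset.sum_nonneg fun _ _ => abs_nonneg _
  have hsplit : D ≤ ∑ i ∈ Finset.Ico ((n / 2 : ℕ) : ℤ) n, |d i| +
      ∑ i ∈ Finset.Ico ((n / 2 : ℕ) : ℤ) n, |d (n - 1 - i)| := by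
    have hN : ((n / 2 : ℕ) : ℤ) ≤ n := by omega
    rw [hD, ← Finset.Ico_union_Ico_eq_Ico (Int.natCast_nonneg (n / 2)) hN,
      Finset.sum_union (Finset.Ico_disjoint_Ico_consecutive _ _ _), add_comm]
    gcongr ?_ + ?_
    · exact le_rfl
    · rw [← Finset.sum_image (f := fun m => |d m|) (g := fun i : ℤ => (n : ℤ) - 1 - i)
        (fun a _ b _ h => by simpa using h)]
      refine Finset.sum_le_sum_of_subset_of_nonneg (fun m hm => ?_) fun _ _ _ => abs_nonneg _
      refine Finset.mem_image.2 ⟨n - 1 - m, ?_, by ring⟩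
      rw [Finset.mem_Ico] at hm ⊢
      omega
  have h3 : D ≤ 2 * (A * (A / ‖innovation x 0‖ ^ 2)) * Y +
      2 * (A * (τ (n / 2) * G / ‖innovation x 0‖ ^ 2)) * D := by
    refine hsplit.trans ((add_le_add h1 h2).trans (le_of_eq ?_))
    simp only [hτ]
    ring
  have h4 := mul_le_mul_of_nonneg_right hn hD0
  linarith

end

/-! ### Least squares as orthogonal projection -/

section

variable {E : Type*} [NormedAddCommGroup E] [InnerProductSpace ℝ E]

/-- A point of a subspace at least as close to `y` as the orthogonal projection is the
projection. -/
theorem eq_starProjection_of_norm_sub_le (K : Submodule ℝ E) [K.HasOrthogonalProjection]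
    {y l : E} (hl : l ∈ K) (h : ‖y - l‖ ^ 2 ≤ ‖y - K.starProjection y‖ ^ 2) :
    l = K.starProjection y := by
  have hmem : K.starProjection y - l ∈ K := K.sub_mem (K.starProjection_apply_mem y) hl
  have horth : inner ℝ (y - K.starProjection y) (K.starProjection y - l) = 0 := by
    rw [real_inner_comm]
    exact K.sub_starProjection_mem_orthogonal y _ hmem
  have hpyth := norm_add_sq_real (y - K.starProjection y) (K.starProjection y - l)
  rw [horth, sub_add_sub_cancel] at hpyth
  have h0 : ‖K.starProjection y - l‖ ^ 2 ≤ 0 := by linarith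
  have h1 : ‖K.starProjection y - l‖ = 0 := by nlinarith [norm_nonneg (K.starProjection y - l)]
  exact (sub_eq_zero.1 (norm_eq_zero.1 h1)).symm

theorem norm_sub_starProjection_sq_le (K : Submodule ℝ E) [K.HasOrthogonalProjection]
    (y : E) {l : E} (hl : l ∈ K) : ‖y - K.starProjection y‖ ^ 2 ≤ ‖y - l‖ ^ 2 := by
  by_contra! h
  exact h.ne (by rw [eq_starProjection_of_norm_sub_le K hl h.le])

instance span_range_hasOrthogonalProjection {n : ℕ} (v : Fin n → E) :
    (Submodule.span ℝ (Set.range v)).HasOrthogonalProjection :=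
  haveI : FiniteDimensional ℝ (Submodule.span ℝ (Set.range v)) :=
    FiniteDimensional.span_of_finite ℝ (Set.finite_range v)
  haveI : CompleteSpace (Submodule.span ℝ (Set.range v)) := FiniteDimensional.complete ℝ _
  inferInstance

theorem isLeast_iff_eq_starProjection {n : ℕ} (v : Fin n → E) (y : E) (b : Fin n → ℝ) :
    (∀ c : Fin n → ℝ, ‖y - ∑ j, b j • v j‖ ^ 2 ≤ ‖y - ∑ j, c j • v j‖ ^ 2) ↔
      ∑ j, b j • v j = (Submodule.span ℝ (Set.range v)).starProjection y := by
  have hmem : ∀ c : Fin n → ℝ, ∑ j, c j • v j ∈ Submodule.span ℝ (Set.range v) := fun c =>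
    Submodule.sum_mem _ fun j _ => Submodule.smul_mem _ _ (Submodule.subset_span ⟨j, rfl⟩)
  constructor
  · intro h
    obtain ⟨c, hc⟩ := (Submodule.mem_span_range_iff_exists_fun ℝ).1
      (Submodule.starProjection_apply_mem (Submodule.span ℝ (Set.range v)) y)
    refine eq_starProjection_of_norm_sub_le _ (hmem b) ?_
    rw [← hc]
    exact h c
  · intro h c
    rw [h]
    exact norm_sub_starProjection_sq_le _ y (hmem c)

theorem existsUnique_isLeast {n : ℕ} {v : Fin n → E} (hv : LinearIndependent ℝ v) (y : E) :
    ∃! b : Fin n → ℝ,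
      ∀ c : Fin n → ℝ, ‖y - ∑ j, b j • v j‖ ^ 2 ≤ ‖y - ∑ j, c j • v j‖ ^ 2 := by
  simp only [isLeast_iff_eq_starProjection]
  obtain ⟨b, hb⟩ := (Submodule.mem_span_range_iff_exists_fun ℝ).1
    (Submodule.starProjection_apply_mem (Submodule.span ℝ (Set.range v)) y)
  refine ⟨b, hb, fun b' hb' => ?_⟩
  have hsub : ∑ j, (b' j - b j) • v j = 0 := by
    simp only [sub_smul, Finset.sum_sub_distrib]
    rw [hb, hb', sub_self]
  funext j
  exact sub_eq_zero.1 (Fintype.linearIndependent_iff.1 hv _ hsub j)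

theorem sum_Ico_int_eq_sum_range {M : Type*} [AddCommMonoid M] (n : ℕ) (f : ℤ → M) :
    ∑ i ∈ Finset.Ico 0 (n : ℤ), f i = ∑ i ∈ Finset.range n, f i := by
  refine Finset.sum_nbij' (fun i => i.toNat) (fun i => (i : ℤ)) ?_ ?_ ?_ ?_ ?_
  · intro i hi; rw [Finset.mem_Ico] at hi; rw [Finset.mem_range]; omega
  · intro i hi; rw [Finset.mem_range] at hi; rw [Finset.mem_Ico]; omega
  · intro i hi; rw [Finset.mem_Ico] at hi; omega
  · intro i _; exact Int.toNat_natCast i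
  · intro i hi; rw [Finset.mem_Ico] at hi; rw [Int.toNat_of_nonneg hi.1]

theorem _root_.MemCPlus.comp_add_one {β : ℝ} (hβ : 0 ≤ β) {a : ℕ → ℝ} (ha : MemCPlus β a) :
    MemCPlus β fun j => a (j + 1) := by
  refine Summable.of_nonneg_of_le
    (fun j => mul_nonneg (one_add_rpow_nonneg _ _) (abs_nonneg _)) (fun j => ?_)
    ((summable_nat_add_iff 1).2 ha)
  refine mul_le_mul_of_nonneg_right (Real.rpow_le_rpow (by positivity) ?_ hβ) (abs_nonneg _)
  push_cast
  linarith

theorem mem_closedSpan_of_hasSum {x : ℤ → E} {K : Set ℤ} {ι : Type*} {f : ι → E} {s : E}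
    (hs : HasSum f s) (hf : ∀ i, f i ∈ closedSpan x K) : s ∈ closedSpan x K :=
  (isClosed_closedSpan x K).mem_of_tendsto hs
    (Eventually.of_forall fun _ => Submodule.sum_mem _ fun i _ => hf i)

/-! ### Closed form and uniqueness of the predictors -/

variable [CompleteSpace E]

/-- The coefficients, on the innovations up to the present, of the projection of the part of the
target that lies in the future. -/
def futureCoeff (x : ℤ → E) (h : ℤ → ℝ) (l : ℕ) : ℝ :=
  ∑' m : ℕ, h (-((m : ℤ) + 1)) * maCoeff x (m + l + 1)

/-- The infinite predictor coefficients in closed form. -/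
def predictorCoeff (x : ℤ → E) (h : ℤ → ℝ) (j : ℕ) : ℝ :=
  h j - cauchyProd (futureCoeff x h) (arCoeff x) j

/-- Assuming joint summability, rather than decay of `h`, lets summable and bounded filters share
the argument. -/
theorem memCPlus_futureCoeff {x : ℤ → E} {h : ℤ → ℝ} {β : ℝ}
    (hK : Summable fun p : ℕ × ℕ => (1 + (p.2 : ℝ)) ^ β *
      (|h (-((p.1 : ℤ) + 1))| * |maCoeff x (p.1 + p.2 + 1)|)) :
    MemCPlus β (futureCoeff x h) := by
  refine Summable.of_nonneg_of_le
    (fun j => mul_nonneg (one_add_rpow_nonneg _ _) (abs_nonneg _)) (fun l => ?_)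
    hK.prod_symm.prod
  have hs : Summable fun m : ℕ => (1 + (l : ℝ)) ^ β *
      (|h (-((m : ℤ) + 1))| * |maCoeff x (m + l + 1)|) := hK.prod_symm.prod_factor l
  have h0 : (1 + (l : ℝ)) ^ β ≠ 0 := (Real.rpow_pos_of_pos (by positivity) _).ne'
  have hs' := (summable_mul_left_iff h0).1 hs
  have hle : |futureCoeff x h l| ≤ ∑' m : ℕ, |h (-((m : ℤ) + 1))| * |maCoeff x (m + l + 1)| := by
    rw [← Real.norm_eq_abs]
    exact tsum_of_norm_bounded hs'.hasSum fun j => by rw [Real.norm_eq_abs, abs_mul]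
  calc _ ≤ (1 + (l : ℝ)) ^ β * ∑' m : ℕ, |h (-((m : ℤ) + 1))| * |maCoeff x (m + l + 1)| :=
        mul_le_mul_of_nonneg_left hle (one_add_rpow_nonneg _ _)
    _ = _ := tsum_mul_left.symm

theorem HasSummableCoeffs.target_summable {x : ℤ → E} (hx : HasSummableCoeffs x) {h : ℤ → ℝ}
    (hh : Summable fun k => h k ^ 2) (n : ℤ) : Summable fun k : ℤ => h k • x (n - k) :=
  hx.summable_smul (f := fun k => n - k) (fun a b hab => by simpa using hab) hh

theorem HasSummableCoeffs.summable_past {x : ℤ → E} (hx : HasSummableCoeffs x) {h : ℤ → ℝ}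
    (hh : Summable fun k => h k ^ 2) (n : ℤ) : Summable fun k : ℕ => h k • x (n - k) :=
  (hx.target_summable hh n).comp_injective Nat.cast_injective

theorem HasSummableCoeffs.hasSum_cauchyProd_arCoeff {x : ℤ → E} (hx : HasSummableCoeffs x)
    {g : ℕ → ℝ} (hg : Summable fun l => |g l|) (n : ℤ) :
    ∃ s, HasSum (fun l : ℕ => g l • innovation x (n - l)) s ∧
      HasSum (fun j : ℕ => cauchyProd g (arCoeff x) j • x (n - j)) (-s) := by
  have hb : ∀ i : ℕ, ‖x (n - i)‖ ≤ ‖x 0‖ := fun i => by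
    have := hx.stationary 0 0 (n - i)
    rw [zero_add, real_inner_self_eq_norm_sq, real_inner_self_eq_norm_sq] at this
    exact ((sq_eq_sq₀ (norm_nonneg _) (norm_nonneg _)).1 this).le
  obtain ⟨s, hs, hs'⟩ := hasSum_cauchyProd_smul hg hx.ar (v := fun i : ℕ => x (n - i))
    (u := fun j : ℕ => -innovation x (n - j)) hb fun j => by
      have := hx.hasSum_ar (n - j)
      simpa only [Nat.cast_add, sub_add_eq_sub_sub] using this
  exact ⟨-s, by simpa using hs.neg, by rwa [neg_neg]⟩

/-- The past half `L1` of the target is its own projection. `L3` has the same inner products as the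
future half `L2` with all ε_i, i ≤ n, hence by Wold with all `x k`, k ≤ n; the AR representation
rewrites `L3` in terms of the process. -/
theorem HasSummableCoeffs.hasSum_predictor {x : ℤ → E} (hx : HasSummableCoeffs x) {h : ℤ → ℝ}
    (hh : Summable fun k => h k ^ 2) (hg : Summable fun l => |futureCoeff x h l|) (n : ℤ) :
    HasSum (fun j : ℕ => predictorCoeff x h j • x (n - j))
      ((closedSpan x (Set.Iic n)).starProjection (target x h n)) := by
  obtain ⟨L3, hL3, hL3'⟩ := hx.hasSum_cauchyProd_arCoeff hg n
  obtain ⟨L1, hL1⟩ := hx.summable_past hh n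
  have hinj : Function.Injective fun m : ℕ => -((m : ℤ) + 1) := fun a b hab => by
    simpa using hab
  obtain ⟨L2, hL2⟩ : Summable fun m : ℕ => h (-((m : ℤ) + 1)) • x (n - -((m : ℤ) + 1)) :=
    (hx.target_summable hh n).comp_injective hinj
  have htarget : target x h n = L1 + L2 :=
    (HasSum.of_nat_of_neg_add_one (f := fun k : ℤ => h k • x (n - k)) hL1 hL2).tsum_eq
  have hsum : HasSum (fun j : ℕ => predictorCoeff x h j • x (n - j)) (L1 + L3) := by
    have := hL1.sub hL3'
    rw [sub_neg_eq_add] at this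
    refine this.congr_fun fun j => ?_
    rw [predictorCoeff, sub_smul]
  have hmem : L1 + L3 ∈ closedSpan x (Set.Iic n) := mem_closedSpan_of_hasSum hsum fun j =>
    Submodule.smul_mem _ _ (mem_closedSpan x (Set.mem_Iic.2 (by omega)))
  have hε : ∀ i : ℤ, i ≤ n → inner ℝ (innovation x i) (L2 - L3) = 0 := by
    intro i hi
    obtain ⟨l, rfl⟩ : ∃ l : ℕ, i = n - l := ⟨(n - i).toNat, by omega⟩
    have h2 := hL2.mapL (innerSL ℝ (innovation x (n - l)))
    have h3 := hL3.mapL (innerSL ℝ (innovation x (n - l)))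
    simp only [innerSL_apply_apply, inner_smul_right] at h2 h3
    have h3' : inner ℝ (innovation x (n - l)) L3 = futureCoeff x h l * ‖innovation x 0‖ ^ 2 := by
      refine h3.unique ?_
      have := hasSum_single (f := fun j : ℕ => futureCoeff x h j *
        inner ℝ (innovation x (n - l)) (innovation x (n - j))) l fun j hj => by
          rw [inner_innovation_innovation _ (by omega), mul_zero]
      rwa [real_inner_self_eq_norm_sq, hx.stationary.norm_innovation] at this
    rw [inner_sub_right, h3', ← h2.tsum_eq, futureCoeff, ← tsum_mul_right, sub_eq_zero]
    refine tsum_congr fun m => ?_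
    rw [real_inner_comm, hx.inner_innovation, if_pos (by omega),
      show (n - -((m : ℤ) + 1) - (n - l)).toNat = m + l + 1 by omega]
    ring
  have horth : ∀ k ∈ Set.Iic n, inner ℝ (x k) (L2 - L3) = 0 := by
    intro k hk
    have h1 := (hx.hasSum_wold k).mapL (innerSL ℝ (L2 - L3))
    simp only [innerSL_apply_apply, inner_smul_right] at h1
    rw [real_inner_comm]
    refine h1.unique (hasSum_zero.congr_fun fun j => ?_)
    rw [real_inner_comm, hε _ (by have := Set.mem_Iic.1 hk; omega), mul_zero]
  rw [Submodule.eq_starProjection_of_mem_of_inner_eq_zero hmem fun v hv => ?_]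
  · exact hsum
  · rw [htarget, add_sub_add_left_eq_sub, real_inner_comm]
    exact inner_eq_zero_of_mem_closedSpan horth hv

/-- A one-sided expansion determines its coefficients. -/
theorem HasSummableCoeffs.eq_zero_of_tendsto {x : ℤ → E} (hx : HasSummableCoeffs x) {n : ℤ}
    {c : ℕ → ℝ}
    (hc : Tendsto (fun N : ℕ => ∑ j ∈ Finset.range N, c j • x (n - j)) atTop (𝓝 0)) (j : ℕ) :
    c j = 0 := by
  induction j using Nat.strong_induction_on with
  | _ j ih =>
    have h1 : Tendsto (fun N : ℕ => inner ℝ (∑ i ∈ Finset.range N, c i • x (n - i))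
        (innovation x (n - j))) atTop (𝓝 (inner ℝ 0 (innovation x (n - j)))) :=
      hc.inner tendsto_const_nhds
    -- Only index `j` survives: smaller indices vanish by induction, larger ones lie strictly before
    -- time `n - j`.
    have h2 : ∀ᶠ N : ℕ in atTop, inner ℝ (∑ i ∈ Finset.range N, c i • x (n - i))
        (innovation x (n - j)) = c j * ‖innovation x 0‖ ^ 2 := by
      filter_upwards [eventually_gt_atTop j] with N hN
      rw [sum_inner, Finset.sum_eq_single j]
      · rw [real_inner_smul_left, inner_self_innovation, hx.stationary.norm_innovation]
      · intro i _ hij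
        rcases hij.lt_or_gt with h | h
        · rw [ih i h, zero_smul, inner_zero_left]
        · rw [real_inner_smul_left, inner_innovation_of_lt x (by omega), mul_zero]
      · intro h
        exact absurd (Finset.mem_range.2 hN) h
    have h3 := tendsto_nhds_unique (tendsto_const_nhds.congr' (h2.mono fun _ h => h.symm)) h1
    rw [inner_zero_left] at h3
    exact (mul_eq_zero.1 h3).resolve_right (pow_pos hx.pos 2).ne'

theorem HasSummableCoeffs.coeff_unique {x : ℤ → E} (hx : HasSummableCoeffs x) {n : ℤ} {L : E}
    {a b : ℕ → ℝ}
    (ha : Tendsto (fun N : ℕ => ∑ j ∈ Finset.range N, a j • x (n - j)) atTop (𝓝 L))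
    (hb : Tendsto (fun N : ℕ => ∑ j ∈ Finset.range N, b j • x (n - j)) atTop (𝓝 L)) : a = b := by
  funext j
  refine sub_eq_zero.1 (hx.eq_zero_of_tendsto (c := fun j => a j - b j) (n := n) ?_ j)
  have := ha.sub hb
  rw [sub_self] at this
  simpa only [sub_smul, Finset.sum_sub_distrib] using this

theorem HasSummableCoeffs.linearIndependent {x : ℤ → E} (hx : HasSummableCoeffs x) (t : ℤ)
    (n : ℕ) : LinearIndependent ℝ fun j : Fin n => x (t - ((j : ℕ) : ℤ)) := by
  rw [Fintype.linearIndependent_iff]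
  intro c hc j
  set c' : ℕ → ℝ := fun i => if h : i < n then c ⟨i, h⟩ else 0 with hc'
  have hcj : ∀ j : Fin n, c' j = c j := fun j => by simp [hc']
  rw [← hcj]
  refine hx.eq_zero_of_tendsto (n := t) (tendsto_const_nhds.congr' ?_) j
  filter_upwards [eventually_ge_atTop n] with N hN
  rw [← hc, ← Finset.sum_subset (Finset.range_mono hN), ← Fin.sum_univ_eq_sum_range
    (fun i => c' i • x (t - i))]
  · simp only [hcj]
  · intro i _ hi
    have : ¬ i < n := by simpa using hi
    simp [hc', this]

theorem HasSummableCoeffs.isInfinitePredictor_iff {x : ℤ → E} (hx : HasSummableCoeffs x)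
    {h : ℤ → ℝ} (hh : Summable fun k => h k ^ 2) (hg : Summable fun l => |futureCoeff x h l|)
    (a : ℕ → ℝ) : IsInfinitePredictor x h a ↔ a = predictorCoeff x h := by
  have hmem : ∀ (n : ℕ) (c : ℕ → ℝ) (M : E), Tendsto (fun N : ℕ =>
      ∑ j ∈ Finset.range N, c j • x ((n : ℤ) - (j : ℤ))) atTop (𝓝 M) →
      M ∈ closedSpan x (Set.Iic (n : ℤ)) := fun n c M hM =>
    (isClosed_closedSpan x _).mem_of_tendsto hM (Eventually.of_forall fun N =>
      Submodule.sum_mem _ fun j _ => Submodule.smul_mem _ _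
        (mem_closedSpan x (Set.mem_Iic.2 (by omega))))
  constructor
  · intro ha
    -- The single time n = 1 already determines the sequence.
    obtain ⟨L, hL, hmin⟩ := ha 1 le_rfl
    have hp := (hx.hasSum_predictor hh hg (1 : ℕ)).tendsto_sum_nat
    have := eq_starProjection_of_norm_sub_le _ (hmem 1 a L hL) (hmin _ _ hp)
    rw [← this] at hp
    exact hx.coeff_unique hL hp
  · rintro rfl n _
    exact ⟨_, (hx.hasSum_predictor hh hg n).tendsto_sum_nat, fun c M hM =>
      norm_sub_starProjection_sq_le _ _ (hmem n c M hM)⟩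

theorem HasSummableCoeffs.predictionWellPosed {x : ℤ → E} (hx : HasSummableCoeffs x)
    {h : ℤ → ℝ} (hh : Summable fun k => h k ^ 2) (hg : Summable fun l => |futureCoeff x h l|) :
    PredictionWellPosed x h where
  target_summable := hx.target_summable hh
  infinite := ⟨_, (hx.isInfinitePredictor_iff hh hg _).2 rfl,
    fun a ha => (hx.isInfinitePredictor_iff hh hg a).1 ha⟩
  finite n _ := existsUnique_isLeast (hx.linearIndependent n n) _

end

/-! ### Error bound and remote correlations -/

section

/-- Take `min (S n) (C * R n)` as the small part; what remains of `S n` is either zero or eventually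
at most `C * Q n`. -/
theorem isLittleOAddBigO_of_le {S R Q f g : ℕ → ℝ} {C : ℝ} (hC : 0 ≤ C) (hS : ∀ n, 0 ≤ S n)
    (hR0 : ∀ n, 0 ≤ R n) (hR : R =o[atTop] f) (hQ : Q =O[atTop] g)
    (hle : ∀ᶠ n in atTop, S n ≤ C * (R n + Q n)) : IsLittleOAddBigO S f g := by
  refine ⟨fun n => min (S n) (C * R n), fun n => S n - min (S n) (C * R n), ?_, ?_,
    Eventually.of_forall fun n => by ring⟩
  · refine IsBigO.trans_isLittleO (IsBigO.of_bound C (Eventually.of_forall fun n => ?_)) hR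
    rw [Real.norm_of_nonneg (le_min (hS n) (mul_nonneg hC (hR0 n))), Real.norm_of_nonneg (hR0 n)]
    exact min_le_right _ _
  · refine IsBigO.trans (IsBigO.of_bound C ?_) hQ
    filter_upwards [hle] with n hn
    rw [Real.norm_of_nonneg (sub_nonneg.2 (min_le_left _ _))]
    have h1 : C * Q n ≤ C * ‖Q n‖ := mul_le_mul_of_nonneg_left (Real.le_norm_self _) hC
    have h2 : 0 ≤ C * ‖Q n‖ := mul_nonneg hC (norm_nonneg _)
    rcases min_choice (S n) (C * R n) with h | h <;> rw [h] <;> linarith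

variable {E : Type*} [NormedAddCommGroup E] [InnerProductSpace ℝ E]

theorem _root_.IsFinitePredictor.inner_eq_zero {x : ℤ → E} {h : ℤ → ℝ} {n : ℕ}
    {b : Fin n → ℝ} (hb : IsFinitePredictor x h n b) {i : ℕ} (hi : i < n) :
    inner ℝ (x (n - i)) (target x h n - ∑ j : Fin n, b j • x ((n : ℤ) - ((j : ℕ) : ℤ))) = 0 := by
  have := (isLeast_iff_eq_starProjection
    (fun j : Fin n => x ((n : ℤ) - ((j : ℕ) : ℤ))) (target x h n) b).1 hb
  rw [this]
  exact Submodule.sub_starProjection_mem_orthogonal _ _ (Submodule.subset_span ⟨⟨i, hi⟩, rfl⟩)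

/-- The correlation of the remote part of the target with `X_1, …, X_n`. -/
def remoteCorrelation (x : ℤ → E) (h : ℤ → ℝ) (n : ℕ) : ℝ :=
  ∑ i ∈ Finset.range n, |inner ℝ (x (i + 1)) (∑' j : ℕ, h (n + j) • x (-j))|

theorem remoteCorrelation_nonneg (x : ℤ → E) (h : ℤ → ℝ) (n : ℕ) :
    0 ≤ remoteCorrelation x h n :=
  Finset.sum_nonneg fun _ _ => abs_nonneg _

theorem hasSum_tail {x : ℤ → E} {a : ℕ → ℝ} {n : ℕ} {s : E}
    (hs : HasSum (fun j : ℕ => a j • x (n - j)) s) :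
    HasSum (fun j : ℕ => a (n + j) • x (-j)) (s - ∑ j ∈ Finset.range n, a j • x (n - j)) := by
  have := (hasSum_nat_add_iff' n).2 hs
  refine this.congr_fun fun j => ?_
  rw [add_comm n j, show (n : ℤ) - ((j + n : ℕ) : ℤ) = -j by push_cast; ring]

variable [CompleteSpace E]

/-- The coefficients carried by the part of the target that lies in the future. -/
def futurePart (x : ℤ → E) (h : ℤ → ℝ) : ℕ → ℝ := cauchyProd (futureCoeff x h) (arCoeff x)

theorem HasSummableCoeffs.hasSum_remote {x : ℤ → E} (hx : HasSummableCoeffs x) {h : ℤ → ℝ}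
    (hh : Summable fun k => h k ^ 2) (n i : ℕ) :
    HasSum (fun j : ℕ => h (n + j) * autocov x (i + 1 + j))
      (inner ℝ (x (i + 1)) (∑' j : ℕ, h (n + j) • x (-j))) := by
  have hs : Summable fun j : ℕ => h (n + j) • x (-j) :=
    hx.summable_smul (f := fun j : ℕ => -(j : ℤ)) (fun a b hab => by simpa using hab)
      (hh.comp_injective (i := fun j : ℕ => (n : ℤ) + j) fun a b hab => by simpa using hab)
  have := hs.hasSum.mapL (innerSL ℝ (x (i + 1)))
  simp only [innerSL_apply_apply, inner_smul_right] at this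
  refine this.congr_fun fun j => ?_
  rw [hx.stationary.inner_eq_autocov, ← hx.stationary.autocov_neg]
  congr 2; ring

theorem HasSummableCoeffs.exists_error_bound {x : ℤ → E} (hx : HasSummableCoeffs x) {h : ℤ → ℝ}
    (hh : Summable fun k => h k ^ 2) (hg : Summable fun l => |futureCoeff x h l|) :
    ∃ C : ℝ, 0 ≤ C ∧ ∀ᶠ n : ℕ in atTop, ∀ (a : ℕ → ℝ) (b : Fin n → ℝ),
      IsInfinitePredictor x h a → IsFinitePredictor x h n b →
      ∑ j : Fin n, |a j - b j| ≤
        C * (∑' i, |futurePart x h (n + i)| + remoteCorrelation x h n) := by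
  obtain ⟨C, hC, hbax⟩ := hx.exists_baxter_bound
  set G := ∑' k, |autocov x k| with hG
  have hG0 : 0 ≤ G := tsum_nonneg fun _ => abs_nonneg _
  have hr : Summable fun j => |futurePart x h j| := by
    have hg0 : MemCPlus 0 (futureCoeff x h) := by simpa [MemCPlus] using hg
    have ha0 : MemCPlus 0 (arCoeff x) := by simpa [MemCPlus] using hx.ar
    exact (hg0.cauchyProd le_rfl ha0).summable_abs le_rfl
  refine ⟨C * (G + 1), by positivity, ?_⟩
  filter_upwards [hbax] with n hn a b ha hb
  obtain rfl := (hx.isInfinitePredictor_iff hh hg a).1 ha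
  set d : ℤ → ℝ := fun i => if hi : 0 ≤ i ∧ i < n then
    predictorCoeff x h i.toNat - b ⟨i.toNat, by omega⟩ else 0 with hd
  have hdj : ∀ j : Fin n, d ((j : ℕ) : ℤ) = predictorCoeff x h j - b j := fun j => by
    have hj := j.2
    rw [hd]
    simp only [Int.toNat_natCast]
    rw [dif_pos ⟨by omega, by omega⟩]
  have hd0 : ∀ i ∉ Finset.Ico 0 (n : ℤ), d i = 0 := fun i hi => by
    rw [Finset.mem_Ico] at hi
    rw [hd]
    exact dif_neg hi
  have hS : ∑ j : Fin n, |predictorCoeff x h j - b j| = ∑ i ∈ Finset.Ico 0 (n : ℤ), |d i| := by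
    rw [sum_Ico_int_eq_sum_range, ← Fin.sum_univ_eq_sum_range (fun i => |d i|)]
    simp only [hdj]
  obtain ⟨s3, hs3, hs3'⟩ := hx.hasSum_cauchyProd_arCoeff hg n
  have hfut := hasSum_tail hs3'
  have htail := hasSum_tail (hx.hasSum_predictor hh hg n)
  set T : E := -s3 - ∑ j ∈ Finset.range n, cauchyProd (futureCoeff x h) (arCoeff x) j • x (n - j)
    with hT
  set H : E := ∑' j : ℕ, h (n + j) • x (-j) with hH
  -- `H` is the tail of `h` and `T` that of g * φ, so `H - T` is the tail of the infinite predictor.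
  have hsplit : H - T = (closedSpan x (Set.Iic (n : ℤ))).starProjection (target x h n) -
      ∑ j ∈ Finset.range n, predictorCoeff x h j • x (n - j) := by
    rw [sub_eq_iff_eq_add, hH]
    refine HasSum.tsum_eq ((htail.add hfut).congr_fun fun j => ?_)
    rw [predictorCoeff, ← add_smul]
    push_cast
    rw [sub_add_cancel]
  -- Coefficient `j` multiplies X_{n-j}, so X_{i+1} sits at position n - 1 - i. Subtracting the
  -- normal equations leaves minus the correlation with `H - T`.
  have htoep : ∀ i < n, toeplitz x n d (n - 1 - i) =
      inner ℝ (x (i + 1)) T - inner ℝ (x (i + 1)) H := by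
    intro i hi
    have hz : toeplitz x n d (n - 1 - i) = inner ℝ (x (i + 1))
        (∑ j : Fin n, (predictorCoeff x h j - b j) • x ((n : ℤ) - ((j : ℕ) : ℤ))) := by
      rw [toeplitz, sum_Ico_int_eq_sum_range, ← Fin.sum_univ_eq_sum_range
        (fun j => d j * autocov x ((j : ℤ) - (n - 1 - i))), inner_sum]
      refine Finset.sum_congr rfl fun j _ => ?_
      rw [hdj, inner_smul_right, hx.stationary.inner_eq_autocov, ← hx.stationary.autocov_neg]
      congr 2; ring
    have ho1 := hb.inner_eq_zero (i := n - 1 - i) (by omega)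
    rw [show (n : ℤ) - ((n - 1 - i : ℕ) : ℤ) = i + 1 by omega] at ho1
    have ho2 : inner ℝ (x (i + 1)) (target x h n -
        (closedSpan x (Set.Iic (n : ℤ))).starProjection (target x h n)) = 0 :=
      Submodule.sub_starProjection_mem_orthogonal _ _
        (mem_closedSpan x (Set.mem_Iic.2 (by omega)))
    have hrange : ∑ j ∈ Finset.range n, predictorCoeff x h j • x ((n : ℤ) - j) =
        ∑ j : Fin n, predictorCoeff x h j • x ((n : ℤ) - ((j : ℕ) : ℤ)) :=
      (Fin.sum_univ_eq_sum_range (fun j => predictorCoeff x h j • x ((n : ℤ) - j)) n).symm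
    rw [hz, ← inner_sub_right, ← neg_sub H T, hsplit, hrange]
    simp only [sub_smul, Finset.sum_sub_distrib]
    simp only [inner_sub_right, inner_neg_right] at ho1 ho2 ⊢
    linarith
  have hTbound : ∑ i ∈ Finset.range n, |inner ℝ (x (i + 1)) T| ≤
      ∑' j, |futurePart x h (n + j)| * G := by
    have hr' : Summable fun j => |futurePart x h (n + j)| :=
      hr.comp_injective (add_right_injective n)
    refine sum_abs_le_tsum_of_hasSum (a := fun j => futurePart x h (n + j)) (B := fun _ => G)
      (f := fun (i : ℕ) j => autocov x ((i : ℤ) + 1 + j)) (fun i _ => ?_) (fun j => ?_)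
      (hr'.mul_right G)
    · have := hfut.mapL (innerSL ℝ (x (i + 1)))
      simp only [innerSL_apply_apply, inner_smul_right] at this
      refine this.congr_fun fun j => ?_
      rw [hx.stationary.inner_eq_autocov, ← hx.stationary.autocov_neg, futurePart]
      congr 2; ring
    · exact hx.sum_abs_autocov_le (f := fun i : ℕ => (i : ℤ) + 1 + j)
        (fun a b hab => by simpa using hab) _
  rw [tsum_mul_right] at hTbound
  have hY : ∑ i ∈ Finset.Ico 0 (n : ℤ), |toeplitz x n d i| ≤
      (∑' j, |futurePart x h (n + j)|) * G + remoteCorrelation x h n := by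
    rw [← sum_Ico_reflect, sum_Ico_int_eq_sum_range]
    refine le_trans (Finset.sum_le_sum fun i hi => ?_)
      ((Finset.sum_add_distrib).le.trans (add_le_add_left hTbound _))
    rw [htoep i (Finset.mem_range.1 hi)]
    exact abs_sub _ _
  have hR0 : 0 ≤ ∑' j, |futurePart x h (n + j)| := tsum_nonneg fun _ => abs_nonneg _
  have hQ0 := remoteCorrelation_nonneg x h n
  rw [hS, mul_assoc]
  refine (hn d hd0).trans (mul_le_mul_of_nonneg_left (hY.trans ?_) hC)
  nlinarith [mul_nonneg hG0 hQ0]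

theorem HasSummableCoeffs.remoteCorrelation_isBigO_tsum {x : ℤ → E} (hx : HasSummableCoeffs x)
    {h : ℤ → ℝ} (hh : Summable fun k => h k ^ 2) (hs : Summable fun k => |h k|) :
    remoteCorrelation x h =O[atTop] fun n : ℕ => ∑' i : ℕ, |h ((n : ℤ) + (i : ℤ))| := by
  refine IsBigO.of_bound (∑' k, |autocov x k|) (Eventually.of_forall fun n => ?_)
  rw [Real.norm_of_nonneg (remoteCorrelation_nonneg x h n),
    Real.norm_of_nonneg (tsum_nonneg fun _ => abs_nonneg _), mul_comm, ← tsum_mul_right]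
  refine sum_abs_le_tsum_of_hasSum (s := Finset.range n) (a := fun j : ℕ => h (n + j))
    (B := fun _ => ∑' k, |autocov x k|) (f := fun (i : ℕ) j => autocov x ((i : ℤ) + 1 + j))
    (fun i _ => hx.hasSum_remote hh n i) (fun j => ?_) ?_
  · exact hx.sum_abs_autocov_le (f := fun i : ℕ => (i : ℤ) + 1 + j)
      (fun a b hab => by simpa using hab) _
  · exact Summable.mul_right _ (hs.comp_injective (i := fun j : ℕ => (n : ℤ) + j)
      fun a b hab => by simpa using hab)

theorem exists_abs_le_of_summable_sq {h : ℤ → ℝ} (hh : Summable fun k => h k ^ 2) :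
    ∃ C, ∀ k, |h k| ≤ C := by
  refine ⟨√(∑' k, h k ^ 2), fun k => Real.abs_le_sqrt ?_⟩
  exact hh.le_tsum k fun _ _ => sq_nonneg _

/-- After the supremum is pulled out, there remains ∑∑ |γ(i+j+1)| = ∑ (1+p) |γ(p+1)|, finite because
γ inherits the first-moment weight of ψ. -/
theorem HasSummableCoeffs.remoteCorrelation_isBigO_iSup {x : ℤ → E} (hx : HasSummableCoeffs x)
    {h : ℤ → ℝ} (hh : Summable fun k => h k ^ 2) (hψ : MemCPlus 1 (maCoeff x)) :
    remoteCorrelation x h =O[atTop] fun n : ℕ => ⨆ i : ℕ, |h ((n : ℤ) + (i : ℤ))| := by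
  obtain ⟨B, hB⟩ := exists_abs_le_of_summable_sq hh
  have hγ : MemCPlus (0 + 1) fun p : ℕ => autocov x (p + 1) := by
    have := (hx.memCPlus_autocov zero_le_one hψ).comp_add_one zero_le_one
    simpa using this
  have hΓ : Summable fun p : ℕ × ℕ => |autocov x ((p.1 + p.2 : ℕ) + 1)| := by
    have := MemCPlus.summable_correlation_of_bounded le_rfl (a := fun _ => 1) (C := 1)
      (by simp) hγ
    simpa using this
  refine IsBigO.of_bound (∑' i : ℕ, ∑' j : ℕ, |autocov x ((i + j : ℕ) + 1)|)
    (Eventually.of_forall fun n => ?_)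
  set s := ⨆ i : ℕ, |h ((n : ℤ) + (i : ℤ))| with hs
  have hle : ∀ j : ℕ, |h (n + j)| ≤ s := fun j =>
    le_ciSup (f := fun i : ℕ => |h ((n : ℤ) + (i : ℤ))|)
      ⟨B, by rintro _ ⟨i, rfl⟩; exact hB _⟩ j
  have hs0 : 0 ≤ s := (abs_nonneg _).trans (hle 0)
  rw [Real.norm_of_nonneg (remoteCorrelation_nonneg x h n), Real.norm_of_nonneg hs0]
  calc _ ≤ ∑ i ∈ Finset.range n, (∑' j : ℕ, |autocov x ((i + j : ℕ) + 1)|) * s := by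
        refine Finset.sum_le_sum fun i _ => ?_
        rw [← Real.norm_eq_abs, ← (hx.hasSum_remote hh n i).tsum_eq]
        have hrow : Summable fun j : ℕ => |autocov x ((i + j : ℕ) + 1)| := hΓ.prod_factor i
        refine tsum_of_norm_bounded (hrow.hasSum.mul_right s) fun j => ?_
        rw [norm_mul, Real.norm_eq_abs, Real.norm_eq_abs, mul_comm,
          show (i : ℤ) + 1 + j = ((i + j : ℕ) : ℤ) + 1 by push_cast; ring]
        exact mul_le_mul_of_nonneg_left (hle j) (abs_nonneg _)
    _ ≤ _ := by
        rw [← Finset.sum_mul]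
        refine mul_le_mul_of_nonneg_right ?_ hs0
        have hrows : Summable fun i : ℕ => ∑' j : ℕ, |autocov x ((i + j : ℕ) + 1)| := hΓ.prod
        exact hrows.sum_le_tsum _ fun _ _ => tsum_nonneg fun _ => abs_nonneg _

/-- The approximation theorem with the remainder of the remote coefficients left abstract. -/
theorem HasSummableCoeffs.predictor_approximation {x : ℤ → E} (hx : HasSummableCoeffs x)
    {h : ℤ → ℝ} {β : ℝ} (hβ : 0 ≤ β) (hφ : MemCPlus β (arCoeff x))
    (hh : Summable fun k => h k ^ 2)
    (hK : Summable fun p : ℕ × ℕ => (1 + (p.2 : ℝ)) ^ β *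
      (|h (-((p.1 : ℤ) + 1))| * |maCoeff x (p.1 + p.2 + 1)|))
    {g : ℕ → ℝ} (hQ : remoteCorrelation x h =O[atTop] g) :
    PredictionWellPosed x h ∧
      ∀ (hhat : ℕ → ℝ) (hhatn : (n : ℕ) → Fin n → ℝ), IsInfinitePredictor x h hhat →
        (∀ n : ℕ, 1 ≤ n → IsFinitePredictor x h n (hhatn n)) →
        IsLittleOAddBigO (fun n => ∑ j : Fin n, |hhat j - hhatn n j|)
          (fun n => (n : ℝ) ^ (-β)) g := by
  have hgβ := memCPlus_futureCoeff hK
  have hg := hgβ.summable_abs hβ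
  refine ⟨hx.predictionWellPosed hh hg, fun a b ha hb => ?_⟩
  obtain ⟨C, hC, hbound⟩ := hx.exists_error_bound hh hg
  refine isLittleOAddBigO_of_le hC (fun n => Finset.sum_nonneg fun _ _ => abs_nonneg _)
    (fun n => tsum_nonneg fun _ => abs_nonneg _)
    ((hgβ.cauchyProd hβ hφ).tail_isLittleO hβ) hQ ?_
  filter_upwards [hbound, eventually_ge_atTop 1] with n hn hn1
  exact hn a (b n) ha (hb n hn1)

theorem summable_sq_of_summable_abs {h : ℤ → ℝ} (hs : Summable fun k => |h k|) :
    Summable fun k => h k ^ 2 := by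
  refine Summable.of_nonneg_of_le (fun k => sq_nonneg _) (fun k => ?_)
    (hs.mul_left (∑' k, |h k|))
  rw [← sq_abs, sq]
  exact mul_le_mul_of_nonneg_right (hs.le_tsum k fun _ _ => abs_nonneg _) (abs_nonneg _)

/-! ### From the process to L² -/

theorem inner_toL2 {Ω : Type*} [MeasurableSpace Ω] {P : Measure Ω} [IsProbabilityMeasure P]
    {X : ℤ → Ω → ℝ} (hX : IsCenteredStationary P X) (s t : ℤ) :
    inner ℝ (hX.toL2 s) (hX.toL2 t) = cov[X s, X t; P] := by
  rw [covariance_eq_sub (hX.memLp s) (hX.memLp t), hX.centered, zero_mul, sub_zero,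
    L2.inner_def]
  refine integral_congr_ae ?_
  filter_upwards [(hX.memLp s).coeFn_toLp, (hX.memLp t).coeFn_toLp] with ω hs ht
  simp only [IsCenteredStationary.toL2, hs, ht, Pi.mul_apply, RCLike.inner_apply, conj_trivial]
  ring

/-- Positive variance makes `X 0` nonzero in L², which with pure nondeterminism keeps the
innovations nonzero. -/
theorem hasSummableCoeffs_toL2 {Ω : Type*} [MeasurableSpace Ω] {P : Measure Ω}
    [IsProbabilityMeasure P] {X : ℤ → Ω → ℝ} (hX : IsCenteredStationary P X)
    (hvar : 0 < Var[X 0; P]) {α : ℝ} (hα : 0 ≤ α) (hSM : ShortMemory hX.toL2 α) :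
    HasSummableCoeffs hX.toL2 := by
  have hst : IsStationary hX.toL2 := fun s t k => by
    rw [inner_toL2, inner_toL2, hX.stationary]
  have h0 : hX.toL2 0 ≠ 0 := fun h => by
    have := inner_toL2 hX 0 0
    rw [h, inner_zero_left, covariance_self (hX.memLp 0).aestronglyMeasurable.aemeasurable]
      at this
    exact hvar.ne this
  exact ⟨hst, hSM.purelyNondeterministic, hst.norm_innovation_pos hSM.purelyNondeterministic h0,
    hSM.ma.summable_abs hα, hSM.ar.summable_abs hα⟩

end

end StationarySequence

end

theorem theorem3p2 {Ω : Type*} [MeasurableSpace Ω] (P : Measure Ω) [IsProbabilityMeasure P]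
    (X : ℤ → Ω → ℝ) (hX : IsCenteredStationary P X) (hvar : 0 < Var[X 0; P])
    (α : ℝ) (hα : 0 ≤ α) (hSM : ShortMemory hX.toL2 α) :
    (∀ h : ℤ → ℝ, (Summable fun k : ℤ => |h k|) →
      PredictionWellPosed hX.toL2 h ∧
      ∀ (hhat : ℕ → ℝ) (hhatn : (n : ℕ) → Fin n → ℝ),
        IsInfinitePredictor hX.toL2 h hhat →
        (∀ n : ℕ, 1 ≤ n → IsFinitePredictor hX.toL2 h n (hhatn n)) →
        IsLittleOAddBigO (fun n => ∑ j : Fin n, |hhat j - hhatn n j|)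
          (fun n => (n : ℝ) ^ (-α))
          (fun n => ∑' i : ℕ, |h ((n : ℤ) + (i : ℤ))|)) ∧
    (1 ≤ α → ∀ h : ℤ → ℝ, (Summable fun k : ℤ => |h k| ^ 2) →
      PredictionWellPosed hX.toL2 h ∧
      ∀ (hhat : ℕ → ℝ) (hhatn : (n : ℕ) → Fin n → ℝ),
        IsInfinitePredictor hX.toL2 h hhat →
        (∀ n : ℕ, 1 ≤ n → IsFinitePredictor hX.toL2 h n (hhatn n)) →
        IsLittleOAddBigO (fun n => ∑ j : Fin n, |hhat j - hhatn n j|)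
          (fun n => (n : ℝ) ^ (-α + 1))
          (fun n => ⨆ i : ℕ, |h ((n : ℤ) + (i : ℤ))|)) := by
  have hx := StationarySequence.hasSummableCoeffs_toL2 hX hvar hα hSM
  constructor
  · intro h hs
    have hh := StationarySequence.summable_sq_of_summable_abs hs
    refine hx.predictor_approximation hα hSM.ar hh ?_ (hx.remoteCorrelation_isBigO_tsum hh hs)
    exact MemCPlus.summable_correlation hα (a := fun m : ℕ => h (-((m : ℤ) + 1)))
      (b := fun q => maCoeff hX.toL2 (q + 1))
      (hs.comp_injective (i := fun m : ℕ => -((m : ℤ) + 1)) fun a b hab => by simpa using hab)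
      (hSM.ma.comp_add_one hα)
  · intro hα1 h hs
    have hh : Summable fun k => h k ^ 2 := by simpa only [sq_abs] using hs
    obtain ⟨B, hB⟩ := StationarySequence.exists_abs_le_of_summable_sq hh
    have hβ : 0 ≤ α - 1 := sub_nonneg.2 hα1
    -- Only boundedness of `h` is used on the future side, so the weight drops to `α - 1`.
    rw [show -α + 1 = -(α - 1) by ring]
    refine hx.predictor_approximation hβ (hSM.ar.mono (by linarith)) hh ?_
      (hx.remoteCorrelation_isBigO_iSup hh (hSM.ma.mono hα1))
    refine MemCPlus.summable_correlation_of_bounded hβ (a := fun m : ℕ => h (-((m : ℤ) + 1)))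
      (b := fun q => maCoeff hX.toL2 (q + 1)) (fun m => hB _) ?_
    rw [sub_add_cancel]
    exact hSM.ma.comp_add_one hα
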